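/- All Hilbert spaces are finite-dimensional, with $|A_1|,|A_2|\ge 2$; $\log$ is to base $2$, and $\|M\|_p=(\operatorname{Tr}(M^\dagger M)^{p/2})^{1/p}$. A subnormalised density matrix is a positive semidefinite matrix of trace at most one. For positive semidefinite $\alpha,\beta$ put $D_2(\alpha\|\beta)=2\log\|\beta^{-1/4}\alpha\beta^{-1/4}\|_2$ if $\operatorname{supp}\alpha\subseteq\operatorname{supp}\beta$ (powers of the Moore–Penrose pseudoinverse, $\log 0=-\infty$) and $D_2(\alpha\|\beta)=+\infty$ otherwise. Let $D_2^\epsilon(\alpha\|\beta)=\min_{\alpha'}D_2(\alpha'\|\beta)$ over all subnormalised density matrices $\alpha'$ with $\|\alpha'-\alpha\|_1\le\epsilon\operatorname{Tr}\alpha$, and let $H_2^\epsilon(X|Y)_\omega=-D_2^\epsilon(\omega^{XY}\|\mathbb 1^X\otimes\omega^Y)$, where superscripts on a state denote its marginals and $2^{-\infty}=0$. Let $\mathcal T^{A_1A_2\to B}$ be a completely positive trace non-increasing superoperator, and let $$\tau^{A_1'A_2'B}=(\mathcal T\otimes\mathbb I^{A_1'A_2'})(\Phi^{A_1'A_1}\otimes\Phi^{A_2'A_2}),\qquad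 \Phi^{A'A}=|A|^{-1}\sum_{a,b=1}^{|A|}|a,a\rangle\langle b,b|,$$ be its Choi state, where $A_i'$ has the same dimension as $A_i$. Let $\rho^{A_1A_2R}$ be a subnormalised density matrix, and for unitaries $U_1$ on $A_1$ and $U_2$ on $A_2$ let $$\sigma^{BR}(U_1,U_2)=(\mathcal T\otimes\mathbb I^R)\big((U_1\otimes U_2\otimes\mathbb 1^R)\,\rho\,(U_1\otimes U_2\otimes\mathbb 1^R)^\dagger\big).$$ Put $D_i=(1-|A_i|^{-2})^{-1/2}$ for $i=1,2$ and $D_{1,2}=2D_1D_2$. Then for every $0<\epsilon<1$, $$\mathbb E_{U_1,U_2}\big\|\sigma^{BR}(U_1,U_2)-\tau^B\otimes\rho^R\big\|_1\le 16\epsilon+2D_1\,2^{-\frac12H_2^\epsilon(A_1|R)_\rho-\frac12H_2^\epsilon(A_1'|B)_\tau}+2D_2\,2^{-\frac12H_2^\epsilon(A_2|R)_\rho-\frac12H_2^\epsilon(A_2'|B)_\tau}+4D_{1,2}\,2^{-\frac12H_2^\epsilon(A_1A_2|R)_\rho-\frac12H_2^\epsilon(A_1'A_2'|B)_\tau},$$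 where $U_1$ and $U_2$ are independent and distributed according to the Haar probability measures on their unitary groups. -/

import Mathlib

open scoped Kronecker ENNReal Matrix ComplexOrder

noncomputable section

namespace Decoupling

/-! A finite-dimensional Hilbert space with a fixed orthonormal basis is represented by the finite
index type of that basis, operators on it by complex square matrices, and the tensor product of
two spaces by the product of the index types. -/

/-! ### Schatten norms, supports and Rényi-2 divergences -/

section Entropy

variable {n : Type*} [Fintype n] [DecidableEq n]

/-- The Schatten `p`-norm `(Tr (M† M)^(p/2))^(1/p)`. -/
def schattenNorm (p : ℝ) (M : Matrix n n ℂ) : ℝ :=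
  ((cfc (fun x : ℝ => x ^ (p / 2)) (Mᴴ * M)).trace.re) ^ (1 / p)

/-- `β^(-1/4)` for a positive semidefinite matrix `β`, in the sense of the Moore-Penrose
pseudoinverse: the eigenvalue `0` is sent to `0`. -/
def invFourthRoot (β : Matrix n n ℂ) : Matrix n n ℂ :=
  cfc (fun x : ℝ => if x = 0 then 0 else x ^ (-(1 / 4) : ℝ)) β

/-- The support of a Hermitian matrix: the span of the eigenvectors with non-zero eigenvalue,
that is, its range. -/
def support (M : Matrix n n ℂ) : Submodule ℂ (n → ℂ) :=
  LinearMap.range M.mulVecLin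

/-- Positive semidefinite with trace at most one. -/
def IsSubnormalised (α : Matrix n n ℂ) : Prop :=
  α.PosSemidef ∧ α.trace.re ≤ 1

/-- Binary logarithm on `[0, ∞]`, with `log 0 = -∞` and `log ∞ = ∞`. -/
def log2 (x : ℝ≥0∞) : EReal :=
  ENNReal.log x / (Real.log 2 : ℝ)

/-- `2 ^ x` for an extended real `x`, with `2 ^ (-∞) = 0` and `2 ^ ∞ = ∞`. -/
def pow2 (x : EReal) : ℝ≥0∞ :=
  EReal.exp (x * (Real.log 2 : ℝ))

open Classical in
/-- The Rényi-2 divergence `2 log ‖β^(-1/4) α β^(-1/4)‖₂` when `supp α ≤ supp β`, and `∞`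
otherwise. -/
def renyiTwoDiv (α β : Matrix n n ℂ) : EReal :=
  if support α ≤ support β then
    2 * log2 (ENNReal.ofReal (schattenNorm 2 (invFourthRoot β * α * invFourthRoot β)))
  else ⊤

/-- The smooth Rényi-2 divergence: the least `D₂(α' ‖ β)` over the subnormalised density matrices
`α'` with `‖α' - α‖₁ ≤ ε Tr α`. -/
def smoothRenyiTwoDiv (ε : ℝ) (α β : Matrix n n ℂ) : EReal :=
  ⨅ α' : {α' : Matrix n n ℂ //
      IsSubnormalised α' ∧ schattenNorm 1 (α' - α) ≤ ε * α.trace.re},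
    renyiTwoDiv α'.1 β

end Entropy

/-! ### Partial traces and the smooth conditional entropy -/

section Bipartite

variable {X Y Z : Type*}

/-- The marginal on `Y` of an operator on `X ⊗ Y`. -/
def traceLeft [Fintype X] (M : Matrix (X × Y) (X × Y) ℂ) : Matrix Y Y ℂ :=
  Matrix.of fun y y' => ∑ x, M (x, y) (x, y')

/-- The marginal on `X ⊗ Z` of an operator on `(X ⊗ Y) ⊗ Z`. -/
def marginalFst [Fintype Y] (M : Matrix ((X × Y) × Z) ((X × Y) × Z) ℂ) :
    Matrix (X × Z) (X × Z) ℂ :=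
  Matrix.of fun p q => ∑ y, M ((p.1, y), p.2) ((q.1, y), q.2)

/-- The marginal on `Y ⊗ Z` of an operator on `(X ⊗ Y) ⊗ Z`. -/
def marginalSnd [Fintype X] (M : Matrix ((X × Y) × Z) ((X × Y) × Z) ℂ) :
    Matrix (Y × Z) (Y × Z) ℂ :=
  Matrix.of fun p q => ∑ x, M ((x, p.1), p.2) ((x, q.1), q.2)

/-- The smooth conditional Rényi-2 entropy `H₂^ε(X|Y)_ω = - D₂^ε(ω^{XY} ‖ 1^X ⊗ ω^Y)`. -/
def smoothCondEntropy [Fintype X] [DecidableEq X] [Fintype Y] [DecidableEq Y]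
    (ε : ℝ) (ω : Matrix (X × Y) (X × Y) ℂ) : EReal :=
  -smoothRenyiTwoDiv ε ω ((1 : Matrix X X ℂ) ⊗ₖ traceLeft ω)

end Bipartite

/-! ### Superoperators and the Choi state -/

section Superoperator

variable {A B : Type*}

/-- The superoperator `T ⊗ 𝕀^R`, which applies `T` to every `R`-block. -/
def ampliate (R : Type*) (T : Matrix A A ℂ →ₗ[ℂ] Matrix B B ℂ) (M : Matrix (A × R) (A × R) ℂ) :
    Matrix (B × R) (B × R) ℂ :=
  Matrix.of fun p q => T (Matrix.of fun a a' => M (a, p.2) (a', q.2)) p.1 q.1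

/-- `T` is completely positive: `T ⊗ 𝕀` preserves positive semidefiniteness for every
finite-dimensional ancilla. -/
def IsCompletelyPositive (T : Matrix A A ℂ →ₗ[ℂ] Matrix B B ℂ) : Prop :=
  ∀ (k : ℕ) (M : Matrix (A × Fin k) (A × Fin k) ℂ), M.PosSemidef → (ampliate (Fin k) T M).PosSemidef

/-- `T` does not increase the trace of positive semidefinite operators. -/
def IsTraceNonincreasing [Fintype A] [Fintype B] (T : Matrix A A ℂ →ₗ[ℂ] Matrix B B ℂ) : Prop :=
  ∀ M : Matrix A A ℂ, M.PosSemidef → (T M).trace.re ≤ M.trace.re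

/-- The EPR state `|A|⁻¹ ∑ |a₁ a₁⟩⟨a₂ a₂|` on two copies of `A`. -/
def epr (A : Type*) [Fintype A] [DecidableEq A] : Matrix (A × A) (A × A) ℂ :=
  Matrix.of fun p q => if p.1 = p.2 ∧ q.1 = q.2 then ((Fintype.card A : ℂ))⁻¹ else 0

variable {A₁ A₂ : Type*} [Fintype A₁] [DecidableEq A₁] [Fintype A₂] [DecidableEq A₂]

/-- The product of EPR states `Φ^{A₁A'₁} ⊗ Φ^{A₂A'₂}`, with the tensor factors ordered as
`(A₁ ⊗ A₂) ⊗ (A'₁ ⊗ A'₂)`. -/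
def eprPair (A₁ A₂ : Type*) [Fintype A₁] [DecidableEq A₁] [Fintype A₂] [DecidableEq A₂] :
    Matrix ((A₁ × A₂) × (A₁ × A₂)) ((A₁ × A₂) × (A₁ × A₂)) ℂ :=
  (epr A₁ ⊗ₖ epr A₂).submatrix (Equiv.prodProdProdComm A₁ A₂ A₁ A₂)
    (Equiv.prodProdProdComm A₁ A₂ A₁ A₂)

/-- The Choi state `τ = (T ⊗ 𝕀^{A'₁A'₂})(Φ^{A₁A'₁} ⊗ Φ^{A₂A'₂})`, with the tensor factors ordered
as `(A'₁ ⊗ A'₂) ⊗ B`. -/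
def choiState (T : Matrix (A₁ × A₂) (A₁ × A₂) ℂ →ₗ[ℂ] Matrix B B ℂ) :
    Matrix ((A₁ × A₂) × B) ((A₁ × A₂) × B) ℂ :=
  (ampliate (A₁ × A₂) T (eprPair A₁ A₂)).submatrix Prod.swap Prod.swap

/-- The unitarily perturbed state
`σ^{BR}(U₁, U₂) = (T ⊗ 𝕀^R)((U₁ ⊗ U₂ ⊗ 1^R) ρ (U₁ ⊗ U₂ ⊗ 1^R)†)`. -/
def perturbedState {R : Type*} [Fintype R] [DecidableEq R]
    (T : Matrix (A₁ × A₂) (A₁ × A₂) ℂ →ₗ[ℂ] Matrix B B ℂ)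
    (ρ : Matrix ((A₁ × A₂) × R) ((A₁ × A₂) × R) ℂ)
    (U₁ : Matrix A₁ A₁ ℂ) (U₂ : Matrix A₂ A₂ ℂ) : Matrix (B × R) (B × R) ℂ :=
  ampliate R T
    (((U₁ ⊗ₖ U₂) ⊗ₖ (1 : Matrix R R ℂ)) * ρ * ((U₁ ⊗ₖ U₂) ⊗ₖ (1 : Matrix R R ℂ))ᴴ)

end Superoperator

/-! ### Haar measure on the unitary group -/

section Haar

variable (n : Type*) [Fintype n] [DecidableEq n]

instance : CompactSpace (Matrix.unitaryGroup n ℂ) := by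
  apply isCompact_iff_compactSpace.mp
  have hK : IsCompact (Set.univ.pi fun _ : n => Set.univ.pi fun _ : n =>
      Metric.closedBall (0 : ℂ) 1) :=
    isCompact_univ_pi fun _ => isCompact_univ_pi fun _ => isCompact_closedBall _ _
  refine hK.of_isClosed_subset (?_ : IsClosed (unitary (Matrix n n ℂ) : Set (Matrix n n ℂ))) ?_
  · exact isClosed_unitary
  · intro U hU i _ j _
    simpa using entry_norm_bound_of_unitary hU i j

instance : MeasurableSpace (Matrix.unitaryGroup n ℂ) := borel _

instance : BorelSpace (Matrix.unitaryGroup n ℂ) := ⟨rfl⟩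

/-- The Haar probability measure on the unitary group. -/
def unitaryHaar : MeasureTheory.Measure (Matrix.unitaryGroup n ℂ) :=
  MeasureTheory.Measure.haarMeasure ⊤

end Haar

/-- The dimensional factor `(1 - |A|⁻²)^(-1/2)`. -/
def dimFactor (A : Type*) [Fintype A] : ℝ :=
  (1 - ((Fintype.card A : ℝ) ^ 2)⁻¹) ^ (-(1 / 2) : ℝ)

end Decoupling

end

/-!
Let `D` be the completely depolarising map. Writing the conjugation by `U₁ ⊗ U₂` as
`((conj U₁ - D) + D) ⊗ ((conj U₂ - D) + D)`, the term `D ⊗ D` produces `τ^B ⊗ ρ^R`, and the other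
three are the fluctuations of one or of both unitaries, each paired with the corresponding
marginals of `τ` and `ρ`. By Schur orthogonality the entries of `conj U - D` have covariance at
most `1 / (d² - 1)`, and such covariance bounds multiply under tensor products, so the case of two
unitaries follows from that of one.

A mean trace norm is then bounded by a mean Hilbert–Schmidt norm through the Cauchy–Schwarz
inequality weighted by fourth roots of the marginals of `τ` and `ρ`, which leaves the exponentials
of the Rényi-2 entropies. Each fluctuation is a difference of completely positive maps whose sum
has mean `c • D` with `c = 2, 2, 4`, so smoothing `τ` and `ρ` costs `2 c ε`: `16 ε` in total.
-/

noncomputable section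

namespace Decoupling

section FrobeniusNorm

variable {m n : Type*} [Fintype m] [Fintype n]

/-- The squared Hilbert–Schmidt norm. It is the square of `schattenNorm 2`, but is polynomial in
the entries, which is what the second-moment computations need. -/
def frobSq (M : Matrix m n ℂ) : ℝ :=
  ∑ i, ∑ j, ‖M i j‖ ^ 2

lemma frobSq_nonneg (M : Matrix m n ℂ) : 0 ≤ frobSq M := by
  unfold frobSq; positivity

lemma continuous_frobSq : Continuous (frobSq : Matrix m n ℂ → ℝ) :=
  continuous_finsetSum _ fun i _ => continuous_finsetSum _ fun j _ =>
    (continuous_id.matrix_elem i j).norm.pow 2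

lemma frobSq_submatrix_equiv {m' n' : Type*} [Fintype m'] [Fintype n'] (M : Matrix m n ℂ)
    (e : m' ≃ m) (f : n' ≃ n) : frobSq (M.submatrix e f) = frobSq M :=
  (Finset.sum_congr rfl fun i _ => f.sum_comp fun j => ‖M (e i) j‖ ^ 2).trans
    (e.sum_comp fun i => ∑ j, ‖M i j‖ ^ 2)

lemma frobSq_vecMulVec (v : m → ℂ) (w : n → ℂ) :
    frobSq (Matrix.vecMulVec v w) = (∑ i, ‖v i‖ ^ 2) * ∑ j, ‖w j‖ ^ 2 := by
  simp only [frobSq, Matrix.vecMulVec_apply, norm_mul, mul_pow, Finset.sum_mul_sum]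

lemma frobSq_kronecker {m' n' : Type*} [Fintype m'] [Fintype n'] (M : Matrix m n ℂ)
    (N : Matrix m' n' ℂ) : frobSq (M ⊗ₖ N) = frobSq M * frobSq N := by
  simp only [frobSq, Matrix.kroneckerMap_apply, norm_mul, mul_pow, Fintype.sum_prod_type,
    Finset.sum_mul_sum]

lemma trace_mul_conjTranspose (M : Matrix m n ℂ) : (M * Mᴴ).trace = (frobSq M : ℂ) := by
  simp [frobSq, Matrix.trace, Matrix.mul_apply, RCLike.mul_conj]

lemma frobSq_of_isHermitian {M : Matrix n n ℂ} (hM : M.IsHermitian) :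
    frobSq M = (M * M).trace.re := by
  have h := trace_mul_conjTranspose M
  rw [hM.eq] at h
  rw [h, Complex.ofReal_re]

lemma re_trace_mul_le_sqrt_frobSq_mul (M : Matrix m n ℂ) (N : Matrix n m ℂ) :
    (M * N).trace.re ≤ √(frobSq M) * √(frobSq N) := by
  calc (M * N).trace.re ≤ ∑ p : m × n, ‖M p.1 p.2‖ * ‖N p.2 p.1‖ := by
        refine (Complex.re_le_norm _).trans ?_
        simp only [Matrix.trace, Matrix.diag, Matrix.mul_apply,
          ← Fintype.sum_prod_type' (f := fun i j => M i j * N j i)]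
        exact (norm_sum_le _ _).trans_eq (by simp only [norm_mul])
    _ ≤ _ := Real.sum_mul_le_sqrt_mul_sqrt _ _ _
    _ = √(frobSq M) * √(frobSq N) := by
        rw [frobSq, frobSq, Fintype.sum_prod_type, Fintype.sum_prod_type_right]

end FrobeniusNorm

section FunctionalCalculus

open scoped MatrixOrder

variable {n : Type*} [Fintype n] [DecidableEq n]

lemma continuousOn_spectrum (f : ℝ → ℝ) (M : Matrix n n ℂ) : ContinuousOn f (spectrum ℝ M) :=
  (Matrix.finite_real_spectrum (A := M)).continuousOn f

lemma cfc_mul_cfc (f g : ℝ → ℝ) (M : Matrix n n ℂ) :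
    cfc f M * cfc g M = cfc (fun x => f x * g x) M :=
  (cfc_mul f g M (continuousOn_spectrum _ _) (continuousOn_spectrum _ _)).symm

lemma posSemidef_cfc {f : ℝ → ℝ} (hf : ∀ x, 0 ≤ f x) (M : Matrix n n ℂ) :
    (cfc f M).PosSemidef :=
  Matrix.nonneg_iff_posSemidef.mp (cfc_nonneg fun x _ => hf x)

lemma cfc_self {M : Matrix n n ℂ} (hM : M.IsHermitian) : cfc (fun x : ℝ => x) M = M :=
  cfc_id' ℝ M (show IsSelfAdjoint M from hM)

lemma nonneg_of_mem_spectrum {M : Matrix n n ℂ} (hM : M.PosSemidef) {x : ℝ}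
    (hx : x ∈ spectrum ℝ M) : 0 ≤ x :=
  spectrum_nonneg_of_nonneg (Matrix.nonneg_iff_posSemidef.mpr hM) hx

end FunctionalCalculus

section TraceNorm

variable {n : Type*} [Fintype n]

lemma re_trace_nonneg {M : Matrix n n ℂ} (hM : M.PosSemidef) : 0 ≤ M.trace.re :=
  (Complex.nonneg_iff.mp hM.trace_nonneg).1

variable [DecidableEq n]

lemma schattenNorm_neg (p : ℝ) (M : Matrix n n ℂ) : schattenNorm p (-M) = schattenNorm p M := by
  rw [schattenNorm, Matrix.conjTranspose_neg, neg_mul_neg, schattenNorm]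

lemma schattenNorm_two (M : Matrix n n ℂ) : schattenNorm 2 M = √(frobSq M) := by
  have h : cfc (fun x : ℝ => x ^ ((2 : ℝ) / 2)) (Mᴴ * M) = Mᴴ * M := by
    simpa only [div_self (two_ne_zero' ℝ), Real.rpow_one] using
      cfc_self (Matrix.isHermitian_conjTranspose_mul_self M)
  rw [schattenNorm, h, Matrix.trace_mul_comm, trace_mul_conjTranspose, Complex.ofReal_re,
    Real.sqrt_eq_rpow]

lemma schattenNorm_one_of_isHermitian {M : Matrix n n ℂ} (hM : M.IsHermitian) :
    schattenNorm 1 M = (cfc (fun x : ℝ => |x|) M).trace.re := by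
  have hsq : Mᴴ * M = cfc (fun x : ℝ => x * x) M := by
    rw [← cfc_mul_cfc, cfc_self hM, hM.eq]
  have hcomp : cfc (fun x : ℝ => x ^ ((1 : ℝ) / 2)) (cfc (fun x : ℝ => x * x) M) =
      cfc (fun x : ℝ => |x|) M := by
    rw [← cfc_comp' _ _ M ((Matrix.finite_real_spectrum.image _).continuousOn _)
      (continuousOn_spectrum _ _) (show IsSelfAdjoint M from hM)]
    simp only [← Real.sqrt_eq_rpow, Real.sqrt_mul_self_eq_abs]
  rw [schattenNorm, hsq, hcomp, div_one, Real.rpow_one]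

lemma schattenNorm_one_of_posSemidef {M : Matrix n n ℂ} (hM : M.PosSemidef) :
    schattenNorm 1 M = M.trace.re := by
  rw [schattenNorm_one_of_isHermitian hM.isHermitian,
    cfc_congr fun x hx => abs_of_nonneg (nonneg_of_mem_spectrum hM hx), cfc_self hM.isHermitian]

lemma schattenNorm_one_nonneg {M : Matrix n n ℂ} (hM : M.IsHermitian) : 0 ≤ schattenNorm 1 M := by
  rw [schattenNorm_one_of_isHermitian hM]
  exact re_trace_nonneg (posSemidef_cfc (fun _ => abs_nonneg _) _)

lemma exists_sub_posSemidef {M : Matrix n n ℂ} (hM : M.IsHermitian) :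
    ∃ P N : Matrix n n ℂ, P.PosSemidef ∧ N.PosSemidef ∧ M = P - N ∧
      schattenNorm 1 M = (P + N).trace.re := by
  refine ⟨cfc (fun x : ℝ => max x 0) M, cfc (fun x : ℝ => max (-x) 0) M,
    posSemidef_cfc (fun x => le_max_right _ _) M, posSemidef_cfc (fun x => le_max_right _ _) M,
    ?_, ?_⟩
  · rw [← cfc_sub _ _ M (continuousOn_spectrum _ _) (continuousOn_spectrum _ _)]
    simp only [max_zero_sub_max_neg_zero_eq_self, cfc_self hM]
  · rw [schattenNorm_one_of_isHermitian hM,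
      ← cfc_add _ _ _ (continuousOn_spectrum _ _) (continuousOn_spectrum _ _)]
    simp only [max_zero_add_max_neg_zero_eq_abs_self]

lemma exists_involution_trace_eq {M : Matrix n n ℂ} (hM : M.IsHermitian) :
    ∃ S : Matrix n n ℂ, S.IsHermitian ∧ S * S = 1 ∧ schattenNorm 1 M = (S * M).trace.re := by
  refine ⟨cfc (fun x : ℝ => if 0 ≤ x then 1 else -1) M, cfc_predicate _ M, ?_, ?_⟩
  · rw [cfc_mul_cfc, ← cfc_const_one ℝ M hM]
    congr 1 with x
    split_ifs <;> norm_num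
  · nth_rewrite 3 [← cfc_self hM]
    rw [schattenNorm_one_of_isHermitian hM, cfc_mul_cfc]
    congr 3 with x
    split_ifs with h
    · rw [one_mul, abs_of_nonneg h]
    · rw [neg_one_mul, abs_of_neg (not_le.mp h)]

lemma re_trace_involution_mul_le {S M : Matrix n n ℂ} (hS : S.IsHermitian) (hS' : S * S = 1)
    (hM : M.PosSemidef) : (S * M).trace.re ≤ M.trace.re := by
  have hsq : (1 - S) * (1 - S) = (2 : ℂ) • (1 - S) := by
    rw [sub_mul, mul_sub, mul_sub, hS', two_smul, one_mul, one_mul, mul_one]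
    abel
  have htr : ((1 - S) * M * (1 - S)ᴴ).trace = 2 * (M.trace - (S * M).trace) := by
    rw [Matrix.conjTranspose_sub, hS.eq, Matrix.conjTranspose_one, Matrix.trace_mul_comm,
      ← mul_assoc, hsq, Matrix.smul_mul, Matrix.trace_smul, sub_mul, Matrix.trace_sub, one_mul,
      smul_eq_mul]
  have hnonneg := re_trace_nonneg (hM.mul_mul_conjTranspose_same (1 - S))
  rw [htr, two_mul, Complex.add_re, Complex.sub_re] at hnonneg
  linarith

lemma schattenNorm_one_sub_le_trace_add {P N : Matrix n n ℂ} (hP : P.PosSemidef)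
    (hN : N.PosSemidef) : schattenNorm 1 (P - N) ≤ (P + N).trace.re := by
  obtain ⟨S, hS, hS', h⟩ := exists_involution_trace_eq (hP.isHermitian.sub hN.isHermitian)
  have hSP := re_trace_involution_mul_le hS hS' hP
  have hSN := re_trace_involution_mul_le hS.neg (by rwa [neg_mul_neg]) hN
  rw [neg_mul, Matrix.trace_neg, Complex.neg_re] at hSN
  rw [h, mul_sub, Matrix.trace_sub, Matrix.trace_add, Complex.sub_re, Complex.add_re]
  linarith

lemma schattenNorm_one_add_le {M N : Matrix n n ℂ} (hM : M.IsHermitian) (hN : N.IsHermitian) :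
    schattenNorm 1 (M + N) ≤ schattenNorm 1 M + schattenNorm 1 N := by
  obtain ⟨P, Q, hP, hQ, rfl, h⟩ := exists_sub_posSemidef hM
  obtain ⟨P', Q', hP', hQ', rfl, h'⟩ := exists_sub_posSemidef hN
  rw [h, h', sub_add_sub_comm]
  refine (schattenNorm_one_sub_le_trace_add (hP.add hP') (hQ.add hQ')).trans_eq ?_
  simp only [Matrix.trace_add, Complex.add_re]
  ring

lemma schattenNorm_one_sub_rev (M N : Matrix n n ℂ) :
    schattenNorm 1 (M - N) = schattenNorm 1 (N - M) := by
  rw [← schattenNorm_neg, neg_sub]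

lemma abs_schattenNorm_one_sub_le {M N : Matrix n n ℂ} (hM : M.IsHermitian) (hN : N.IsHermitian) :
    |schattenNorm 1 M - schattenNorm 1 N| ≤ schattenNorm 1 (M - N) := by
  have h₁ := schattenNorm_one_add_le (hM.sub hN) hN
  have h₂ := schattenNorm_one_add_le (hN.sub hM) hM
  rw [sub_add_cancel] at h₁ h₂
  rw [schattenNorm_one_sub_rev] at h₂
  exact abs_sub_le_iff.mpr ⟨by linarith, by linarith⟩

lemma frobSq_involution_conj {S : Matrix n n ℂ} (hS : S.IsHermitian) (hS' : S * S = 1)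
    (M : Matrix n n ℂ) : frobSq (S * M * S) = frobSq M := by
  have h : S * M * S * (S * M * S)ᴴ = S * (M * Mᴴ * S) := by
    simp only [Matrix.conjTranspose_mul, hS.eq, mul_assoc, ← mul_assoc S S, hS', one_mul]
  rw [← Complex.ofReal_inj, ← trace_mul_conjTranspose, h, Matrix.trace_mul_comm, mul_assoc, hS',
    mul_one, trace_mul_conjTranspose]

lemma frobSq_conj_involution_le {Q S : Matrix n n ℂ} (hQ : Q.IsHermitian) (hS : S.IsHermitian)
    (hS' : S * S = 1) : frobSq (Q * S * Q) ≤ frobSq (Q * Q) := by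
  have hQSQ : (Q * S * Q).IsHermitian := by
    simpa only [hQ.eq] using Matrix.isHermitian_mul_mul_conjTranspose Q hS
  calc frobSq (Q * S * Q) = (Q * Q * (S * (Q * Q) * S)).trace.re := by
        rw [frobSq_of_isHermitian hQSQ, ← mul_assoc (Q * S * Q), Matrix.trace_mul_comm]
        simp only [mul_assoc]
    _ ≤ √(frobSq (Q * Q)) * √(frobSq (S * (Q * Q) * S)) := re_trace_mul_le_sqrt_frobSq_mul _ _
    _ = frobSq (Q * Q) := by
        rw [frobSq_involution_conj hS hS', Real.mul_self_sqrt (frobSq_nonneg _)]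

lemma schattenNorm_one_conj_le {Q Y : Matrix n n ℂ} (hQ : Q.IsHermitian) (hY : Y.IsHermitian) :
    schattenNorm 1 (Q * Y * Q) ≤ √(frobSq (Q * Q)) * √(frobSq Y) := by
  have hQYQ : (Q * Y * Q).IsHermitian := by
    simpa only [hQ.eq] using Matrix.isHermitian_mul_mul_conjTranspose Q hY
  obtain ⟨S, hS, hS', h⟩ := exists_involution_trace_eq hQYQ
  calc schattenNorm 1 (Q * Y * Q) = (Q * S * Q * Y).trace.re := by
        rw [h, ← mul_assoc, Matrix.trace_mul_comm]
        simp only [mul_assoc]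
    _ ≤ √(frobSq (Q * S * Q)) * √(frobSq Y) := re_trace_mul_le_sqrt_frobSq_mul _ _
    _ ≤ √(frobSq (Q * Q)) * √(frobSq Y) := by
        gcongr
        exact frobSq_conj_involution_le hQ hS hS'

lemma continuous_schattenNorm_one {X : Type*} [TopologicalSpace X] {f : X → Matrix n n ℂ}
    (hf : Continuous f) (hf' : ∀ x, (f x).IsHermitian) :
    Continuous fun x => schattenNorm 1 (f x) := by
  refine continuous_iff_continuousAt.mpr fun x => tendsto_iff_dist_tendsto_zero.mpr ?_
  have hbound (y : X) : dist (schattenNorm 1 (f y)) (schattenNorm 1 (f x)) ≤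
      √(frobSq (1 * 1 : Matrix n n ℂ)) * √(frobSq (f y - f x)) := by
    refine (abs_schattenNorm_one_sub_le (hf' y) (hf' x)).trans ?_
    simpa only [one_mul, mul_one] using
      schattenNorm_one_conj_le Matrix.isHermitian_one ((hf' y).sub (hf' x))
  refine squeeze_zero (fun _ => dist_nonneg) hbound ?_
  have hcont : Continuous fun y => √(frobSq (1 * 1 : Matrix n n ℂ)) * √(frobSq (f y - f x)) :=
    continuous_const.mul (continuous_frobSq.comp (hf.sub continuous_const)).sqrt
  simpa [frobSq] using hcont.tendsto x

end TraceNorm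

section Commutant

variable {n : Type*} [Fintype n] [DecidableEq n]

/-- The operator exchanging the two copies of a space in its tensor square. -/
def swapMatrix (n : Type*) [DecidableEq n] : Matrix (n × n) (n × n) ℂ :=
  Matrix.of fun p q => if p.1 = q.2 ∧ p.2 = q.1 then 1 else 0

lemma swapMatrix_mul_kronecker (M N : Matrix n n ℂ) :
    swapMatrix n * (M ⊗ₖ N) = (N ⊗ₖ M) * swapMatrix n := by
  ext ⟨i, j⟩ ⟨k, l⟩
  simp [swapMatrix, Matrix.mul_apply, Fintype.sum_prod_type, ite_and, mul_comm]

lemma trace_swapMatrix_mul_kronecker (M N : Matrix n n ℂ) :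
    (swapMatrix n * (M ⊗ₖ N)).trace = (M * N).trace := by
  rw [Matrix.trace_mul_comm (swapMatrix n)]
  simp [swapMatrix, Matrix.trace, Matrix.mul_apply, Fintype.sum_prod_type, ite_and]

lemma trace_swapMatrix : (swapMatrix n).trace = Fintype.card n := by
  simpa using trace_swapMatrix_mul_kronecker (1 : Matrix n n ℂ) 1

lemma swapMatrix_mul_self : swapMatrix n * swapMatrix n = 1 := by
  ext ⟨i, j⟩ ⟨k, l⟩
  simp [swapMatrix, Matrix.mul_apply, Fintype.sum_prod_type, ite_and, Matrix.one_apply]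

/-- The diagonal unitary with entry `i` at the coordinate `p` and `1` elsewhere; commuting with
all of them forces the entries of a matrix off a few positions to vanish. -/
def phaseMatrix (p : n) : Matrix n n ℂ :=
  Matrix.diagonal fun i => if i = p then Complex.I else 1

lemma phaseMatrix_mem_unitaryGroup (p : n) : phaseMatrix p ∈ Matrix.unitaryGroup n ℂ := by
  rw [Matrix.mem_unitaryGroup_iff, phaseMatrix, Matrix.star_eq_conjTranspose,
    Matrix.diagonal_conjTranspose, Matrix.diagonal_mul_diagonal, ← Matrix.diagonal_one]
  congr 1 with i
  by_cases h : i = p <;> simp [h]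

lemma permMatrix_mem_unitaryGroup (σ : Equiv.Perm n) :
    σ.permMatrix ℂ ∈ Matrix.unitaryGroup n ℂ := by
  rw [Matrix.mem_unitaryGroup_iff, Matrix.star_eq_conjTranspose, Matrix.conjTranspose_permMatrix,
    ← Matrix.permMatrix_mul, inv_mul_cancel, Matrix.permMatrix_one]

/-- The reflection in the hyperplane orthogonal to `e_i + 2 e_j`. Unlike phases and permutations
it mixes two basis vectors, with unequal entries so that it does not preserve the span of the
vectors `e_i ⊗ e_i`. -/
def mixingMatrix (i j : n) : Matrix n n ℂ :=
  1 - (2 / 5 : ℂ) • Matrix.vecMulVec (Pi.single i 1 + Pi.single j 2) (Pi.single i 1 + Pi.single j 2)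

lemma mixingMatrix_mem_unitaryGroup {i j : n} (hij : i ≠ j) :
    mixingMatrix i j ∈ Matrix.unitaryGroup n ℂ := by
  set v : n → ℂ := Pi.single i 1 + Pi.single j 2 with hv
  have hstar : star v = v := by
    rw [hv, star_add, ← Pi.single_star, ← Pi.single_star, star_one, star_ofNat]
  have hself : star (mixingMatrix i j) = mixingMatrix i j := by
    rw [Matrix.star_eq_conjTranspose, mixingMatrix, ← hv, Matrix.conjTranspose_sub,
      Matrix.conjTranspose_smul, Matrix.conjTranspose_vecMulVec, hstar, Matrix.conjTranspose_one,
      star_div₀, star_ofNat, star_ofNat]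
  have hnorm : v ⬝ᵥ v = 5 := by
    simp only [hv, dotProduct_add, dotProduct_single, Pi.add_apply, Pi.single_eq_same,
      Pi.single_eq_of_ne hij, Pi.single_eq_of_ne hij.symm]
    norm_num
  rw [Matrix.mem_unitaryGroup_iff, hself, mixingMatrix, ← hv, sub_mul, mul_sub, mul_sub,
    smul_mul_smul_comm, Matrix.vecMulVec_mul_vecMulVec, hnorm]
  simp only [one_mul, mul_one, Matrix.vecMulVec_smul, smul_smul]
  module

lemma eq_smul_one_of_commute [Nonempty n] {N : Matrix n n ℂ}
    (h : ∀ W ∈ Matrix.unitaryGroup n ℂ, W * N = N * W) : ∃ a : ℂ, N = a • 1 := by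
  have hoff (i j : n) (hij : i ≠ j) : N i j = 0 := by
    have hij' := congrFun₂ (h _ (phaseMatrix_mem_unitaryGroup i)) i j
    simp only [phaseMatrix, Matrix.diagonal_mul, Matrix.mul_diagonal, if_true,
      if_neg hij.symm, mul_one] at hij'
    have hI : Complex.I ≠ 1 := fun h => by simpa using congrArg Complex.re h
    by_contra hN
    exact hI ((mul_eq_left₀ hN).mp (by rw [mul_comm, hij']))
  have hdiag (i j : n) : N i i = N j j := by
    have hij := congrFun₂ (h _ (permMatrix_mem_unitaryGroup (Equiv.swap j i))) j i
    simpa [PEquiv.toMatrix_toPEquiv_mul, PEquiv.mul_toMatrix_toPEquiv] using hij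
  obtain ⟨i₀⟩ := ‹Nonempty n›
  refine ⟨N i₀ i₀, ?_⟩
  ext i j
  by_cases hij : i = j
  · subst hij
    simp [hdiag i i₀]
  · simp [hij, hoff i j hij]

lemma exists_perm_apply_eq {n : Type*} {i j k l : n} (hij : i ≠ j) (hkl : k ≠ l) :
    ∃ σ : Equiv.Perm n, σ i = k ∧ σ j = l := by
  classical
  refine ⟨(Equiv.swap i k).trans (Equiv.swap (Equiv.swap i k j) l), ?_, ?_⟩
  · have hk : k ≠ Equiv.swap i k j := by
      rw [ne_comm, Ne, Equiv.swap_apply_eq_iff, Equiv.swap_apply_right]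
      exact hij.symm
    rw [Equiv.trans_apply, Equiv.swap_apply_left, Equiv.swap_apply_of_ne_of_ne hk hkl]
  · rw [Equiv.trans_apply, Equiv.swap_apply_left]

lemma pair_eq_or_eq_swap_of_phases {n : Type*} [DecidableEq n] {i j k l : n}
    (h : ∀ p : n, (if i = p then Complex.I else 1) * (if j = p then Complex.I else 1) =
      (if k = p then Complex.I else 1) * (if l = p then Complex.I else 1)) :
    (i = k ∧ j = l) ∨ (i = l ∧ j = k) := by
  have hI₁ : Complex.I ≠ 1 := fun h => by simpa using congrArg Complex.re h
  have hI₂ := Complex.I_mul_I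
  have hi := h i
  have hj := h j
  grind

lemma apply_eq_zero_of_commute_phaseMatrix {N : Matrix (n × n) (n × n) ℂ}
    (h : ∀ p, (phaseMatrix p ⊗ₖ phaseMatrix p) * N = N * (phaseMatrix p ⊗ₖ phaseMatrix p))
    {i j k l : n} (hne : ¬ ((i = k ∧ j = l) ∨ (i = l ∧ j = k))) : N (i, j) (k, l) = 0 := by
  by_contra hN
  refine hne (pair_eq_or_eq_swap_of_phases fun p => ?_)
  have hp := congrFun₂ (h p) (i, j) (k, l)
  rw [phaseMatrix, Matrix.diagonal_kronecker_diagonal, Matrix.diagonal_mul,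
    Matrix.mul_diagonal, mul_comm] at hp
  exact mul_left_cancel₀ hN hp

lemma apply_perm_of_commute_permMatrix {N : Matrix (n × n) (n × n) ℂ} {σ : Equiv.Perm n}
    (h : (σ.permMatrix ℂ ⊗ₖ σ.permMatrix ℂ) * N = N * (σ.permMatrix ℂ ⊗ₖ σ.permMatrix ℂ))
    (i j k l : n) : N (σ i, σ j) (σ k, σ l) = N (i, j) (k, l) := by
  have hσ := congrFun₂ h (i, j) (σ k, σ l)
  simpa [Equiv.Perm.permMatrix, Equiv.toPEquiv_apply, PEquiv.toMatrix_apply, Matrix.mul_apply,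
    Fintype.sum_prod_type, ite_and, eq_comm] using hσ

lemma exists_eq_smul_add_smul_diagonal_of_commute [Nontrivial n] {N : Matrix (n × n) (n × n) ℂ}
    (hphase : ∀ p, (phaseMatrix p ⊗ₖ phaseMatrix p) * N = N * (phaseMatrix p ⊗ₖ phaseMatrix p))
    (hperm : ∀ σ : Equiv.Perm n,
      (σ.permMatrix ℂ ⊗ₖ σ.permMatrix ℂ) * N = N * (σ.permMatrix ℂ ⊗ₖ σ.permMatrix ℂ)) :
    ∃ a b c : ℂ, N = a • 1 + b • swapMatrix n +
      c • Matrix.diagonal (fun p : n × n => if p.1 = p.2 then (1 : ℂ) else 0) := by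
  obtain ⟨i₀, j₀, h₀⟩ := exists_pair_ne n
  refine ⟨N (i₀, j₀) (i₀, j₀), N (i₀, j₀) (j₀, i₀),
    N (i₀, i₀) (i₀, i₀) - N (i₀, j₀) (i₀, j₀) - N (i₀, j₀) (j₀, i₀), ?_⟩
  ext ⟨i, j⟩ ⟨k, l⟩
  by_cases hne : (i = k ∧ j = l) ∨ (i = l ∧ j = k)
  · by_cases hij : i = j
    · obtain ⟨rfl, rfl⟩ : i = k ∧ i = l := by grind
      subst hij
      have hi := apply_perm_of_commute_permMatrix (hperm (Equiv.swap i₀ i)) i₀ i₀ i₀ i₀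
      rw [Equiv.swap_apply_left] at hi
      simp [swapMatrix, hi]
    · obtain ⟨σ, rfl, rfl⟩ := exists_perm_apply_eq h₀ hij
      rcases hne with ⟨rfl, rfl⟩ | ⟨rfl, rfl⟩ <;>
        simp [swapMatrix, apply_perm_of_commute_permMatrix (hperm σ), h₀]
  · rw [apply_eq_zero_of_commute_phaseMatrix hphase hne]
    simp only [swapMatrix, Matrix.add_apply, Matrix.smul_apply, Matrix.one_apply, Matrix.of_apply,
      Matrix.diagonal_apply, Prod.mk.injEq, smul_eq_mul]
    grind

lemma eq_smul_one_add_smul_swapMatrix_of_commute [Nontrivial n] {N : Matrix (n × n) (n × n) ℂ}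
    (h : ∀ W ∈ Matrix.unitaryGroup n ℂ, (W ⊗ₖ W) * N = N * (W ⊗ₖ W)) :
    ∃ a b : ℂ, N = a • 1 + b • swapMatrix n := by
  obtain ⟨a, b, c, hN⟩ := exists_eq_smul_add_smul_diagonal_of_commute
    (fun p => h _ (phaseMatrix_mem_unitaryGroup p)) (fun σ => h _ (permMatrix_mem_unitaryGroup σ))
  refine ⟨a, b, ?_⟩
  obtain ⟨i, j, hij⟩ := exists_pair_ne n
  have hmix := congrFun₂ (h _ (mixingMatrix_mem_unitaryGroup hij)) (i, i) (i, j)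
  rw [hN] at hmix
  simp only [mul_add, add_mul, Matrix.mul_smul, Matrix.smul_mul, mul_one, one_mul,
    swapMatrix_mul_kronecker, Matrix.add_apply, Matrix.smul_apply, Matrix.mul_diagonal,
    Matrix.diagonal_mul, if_neg hij, if_true, mul_zero, smul_zero, add_zero,
    Matrix.kroneckerMap_apply] at hmix
  have hne : mixingMatrix i j i i * mixingMatrix i j i j ≠ 0 := by
    norm_num [mixingMatrix, Matrix.vecMulVec_apply, hij, hij.symm]
  have hc : c * (mixingMatrix i j i i * mixingMatrix i j i j) = 0 := add_eq_left.mp hmix.symm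
  rw [hN, (mul_eq_zero.mp hc).resolve_right hne, zero_smul, add_zero]

end Commutant

open MeasureTheory

section MatrixIntegral

lemma integrable_of_continuous {Ω : Type*} [TopologicalSpace Ω] [CompactSpace Ω]
    [MeasurableSpace Ω] [OpensMeasurableSpace Ω] (μ : Measure Ω) [IsFiniteMeasure μ]
    {E : Type*} [NormedAddCommGroup E] [SecondCountableTopology E] {f : Ω → E} (hf : Continuous f) :
    Integrable f μ := by
  borelize E
  obtain ⟨C, hC⟩ := (isCompact_range hf).isBounded.exists_norm_le
  exact Integrable.of_bound hf.measurable.aestronglyMeasurable C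
    (.of_forall fun x => hC _ ⟨x, rfl⟩)

variable {Ω : Type*} [MeasurableSpace Ω] {m n p : Type*}

/-- The entrywise integral of a matrix-valued function. -/
def matrixIntegral (μ : Measure Ω) (F : Ω → Matrix m n ℂ) : Matrix m n ℂ :=
  Matrix.of fun i j => ∫ ω, F ω i j ∂μ

variable {μ : Measure Ω}

lemma mul_matrixIntegral [Fintype m] (C : Matrix p m ℂ) {F : Ω → Matrix m n ℂ}
    (hF : ∀ i j, Integrable (fun ω => F ω i j) μ) :
    C * matrixIntegral μ F = matrixIntegral μ fun ω => C * F ω := by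
  ext i j
  simp only [matrixIntegral, Matrix.mul_apply, Matrix.of_apply]
  rw [integral_finsetSum _ fun k _ => (hF k j).const_mul _]
  simp only [integral_const_mul]

lemma matrixIntegral_mul [Fintype n] (C : Matrix n p ℂ) {F : Ω → Matrix m n ℂ}
    (hF : ∀ i j, Integrable (fun ω => F ω i j) μ) :
    matrixIntegral μ F * C = matrixIntegral μ fun ω => F ω * C := by
  ext i j
  simp only [matrixIntegral, Matrix.mul_apply, Matrix.of_apply]
  rw [integral_finsetSum _ fun k _ => (hF i k).mul_const _]
  simp only [integral_mul_const]

lemma trace_matrixIntegral [Fintype n] {F : Ω → Matrix n n ℂ}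
    (hF : ∀ i j, Integrable (fun ω => F ω i j) μ) :
    (matrixIntegral μ F).trace = ∫ ω, (F ω).trace ∂μ := by
  simp only [matrixIntegral, Matrix.trace, Matrix.diag, Matrix.of_apply]
  rw [integral_finsetSum _ fun k _ => hF k k]

end MatrixIntegral

section Twirl

variable {m n : Type*} [Fintype m] [DecidableEq m] [Fintype n] [DecidableEq n]

instance : SecondCountableTopology (Matrix.unitaryGroup n ℂ) :=
  inferInstanceAs (SecondCountableTopology
    {U : n → n → ℂ // U ∈ (Matrix.unitaryGroup n ℂ : Set (Matrix n n ℂ))})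

instance : (unitaryHaar n).IsMulLeftInvariant := by
  unfold unitaryHaar; infer_instance

instance : IsProbabilityMeasure (unitaryHaar n) where
  measure_univ := by
    simpa only [unitaryHaar, TopologicalSpace.PositiveCompacts.coe_top] using
      Measure.haarMeasure_self
        (K₀ := (⊤ : TopologicalSpace.PositiveCompacts (Matrix.unitaryGroup n ℂ)))

/-- The average of `Z` over conjugations by the unitary representation `π` of the unitary group.
The representation is given on all matrices because the ones needed here are polynomial. -/
def twirl (π : Matrix n n ℂ →⋆* Matrix m m ℂ) (Z : Matrix m m ℂ) : Matrix m m ℂ :=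
  matrixIntegral (unitaryHaar n) fun U => π U * Z * (π U)ᴴ

variable {π : Matrix n n ℂ →⋆* Matrix m m ℂ}

lemma map_conjTranspose_mul_map (π : Matrix n n ℂ →⋆* Matrix m m ℂ)
    (U : Matrix.unitaryGroup n ℂ) : (π U)ᴴ * π U = 1 := by
  rw [← Matrix.star_eq_conjTranspose, ← map_star, ← map_mul, Unitary.coe_star_mul_self, map_one]

lemma integrable_mul_map_conj (hπ : Continuous π) (C Z : Matrix m m ℂ) (i j : m) :
    Integrable (fun U : Matrix.unitaryGroup n ℂ => (C * (π U * Z * (π U)ᴴ)) i j)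
      (unitaryHaar n) := by
  have h : Continuous fun U : Matrix.unitaryGroup n ℂ => π U := hπ.comp continuous_subtype_val
  exact integrable_of_continuous _ (continuous_const.matrix_mul
    ((h.matrix_mul continuous_const).matrix_mul h.matrix_conjTranspose) |>.matrix_elem i j)

lemma integrable_map_conj (hπ : Continuous π) (Z : Matrix m m ℂ) (i j : m) :
    Integrable (fun U : Matrix.unitaryGroup n ℂ => (π U * Z * (π U)ᴴ) i j) (unitaryHaar n) := by
  simpa only [one_mul] using integrable_mul_map_conj hπ 1 Z i j

lemma trace_mul_twirl (hπ : Continuous π) (C Z : Matrix m m ℂ) :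
    (C * twirl π Z).trace = ∫ U, (C * (π U * Z * (π U)ᴴ)).trace ∂(unitaryHaar n) := by
  rw [twirl, mul_matrixIntegral _ (integrable_map_conj hπ Z),
    trace_matrixIntegral (integrable_mul_map_conj hπ C Z)]

lemma trace_mul_twirl_of_commute (hπ : Continuous π) {C : Matrix m m ℂ}
    (hC : ∀ U : Matrix.unitaryGroup n ℂ, C * π U = π U * C) (Z : Matrix m m ℂ) :
    (C * twirl π Z).trace = (C * Z).trace := by
  have htr (U : Matrix.unitaryGroup n ℂ) : (C * (π U * Z * (π U)ᴴ)).trace = (C * Z).trace := by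
    rw [← mul_assoc, ← mul_assoc, hC, Matrix.trace_mul_comm, ← mul_assoc, ← mul_assoc,
      map_conjTranspose_mul_map, one_mul]
  simp only [trace_mul_twirl hπ, htr, integral_const, probReal_univ, one_smul]

lemma conj_twirl (hπ : Continuous π) (Z : Matrix m m ℂ) (W : Matrix.unitaryGroup n ℂ) :
    π W * twirl π Z * (π W)ᴴ = twirl π Z := by
  rw [twirl, mul_matrixIntegral _ (integrable_map_conj hπ Z),
    matrixIntegral_mul _ (integrable_mul_map_conj hπ _ Z)]
  ext i j
  simp only [matrixIntegral, Matrix.of_apply]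
  rw [← integral_mul_left_eq_self (fun U : Matrix.unitaryGroup n ℂ => (π U * Z * (π U)ᴴ) i j) W]
  simp only [Submonoid.coe_mul, map_mul, Matrix.conjTranspose_mul, mul_assoc]

lemma commute_twirl (hπ : Continuous π) (Z : Matrix m m ℂ) (W : Matrix n n ℂ)
    (hW : W ∈ Matrix.unitaryGroup n ℂ) : π W * twirl π Z = twirl π Z * π W := by
  nth_rewrite 2 [← conj_twirl hπ Z ⟨W, hW⟩]
  rw [mul_assoc _ _ (π W), map_conjTranspose_mul_map π ⟨W, hW⟩, mul_one]

lemma twirl_id [Nonempty n] (Z : Matrix n n ℂ) :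
    twirl (StarMonoidHom.id _) Z = (Z.trace / Fintype.card n) • 1 := by
  obtain ⟨a, ha⟩ := eq_smul_one_of_commute
    (commute_twirl (π := StarMonoidHom.id (Matrix n n ℂ)) continuous_id Z)
  have htr := trace_mul_twirl_of_commute (π := .id _) continuous_id (C := 1) (fun _ => by simp) Z
  rw [ha, one_mul, one_mul, Matrix.trace_smul, Matrix.trace_one, smul_eq_mul] at htr
  rw [ha, ← htr, mul_div_cancel_right₀ _ (Nat.cast_ne_zero.mpr Fintype.card_ne_zero)]

/-- The representation `U ↦ U ⊗ U`. -/
def kroneckerSelf (n : Type*) [Fintype n] [DecidableEq n] :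
    Matrix n n ℂ →⋆* Matrix (n × n) (n × n) ℂ where
  toFun U := U ⊗ₖ U
  map_one' := Matrix.one_kronecker_one
  map_mul' U V := Matrix.mul_kronecker_mul U V U V
  map_star' U := (Matrix.conjTranspose_kronecker U U).symm

lemma continuous_kroneckerSelf : Continuous (kroneckerSelf n) :=
  continuous_matrix fun _ _ =>
    (continuous_id.matrix_elem _ _).mul (continuous_id.matrix_elem _ _)

lemma one_lt_card_real (n : Type*) [Fintype n] [Nontrivial n] : (1 : ℝ) < Fintype.card n := by
  exact_mod_cast Fintype.one_lt_card

lemma card_sq_sub_one_pos (n : Type*) [Fintype n] [Nontrivial n] :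
    (0 : ℝ) < (Fintype.card n : ℝ) ^ 2 - 1 := by
  nlinarith [one_lt_card_real n]

lemma twirl_kroneckerSelf [Nontrivial n] {Z : Matrix (n × n) (n × n) ℂ} (hZ : Z.trace = 0) :
    twirl (kroneckerSelf n) Z = ((swapMatrix n * Z).trace / ((Fintype.card n : ℂ) ^ 2 - 1)) •
      (swapMatrix n - (Fintype.card n : ℂ)⁻¹ • 1) := by
  obtain ⟨a, b, hab⟩ := eq_smul_one_add_smul_swapMatrix_of_commute
    (commute_twirl continuous_kroneckerSelf Z)
  have htr := trace_mul_twirl_of_commute (C := 1) (continuous_kroneckerSelf (n := n))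
    (fun _ => by rw [one_mul, mul_one]) Z
  have hswap := trace_mul_twirl_of_commute continuous_kroneckerSelf
    (fun U : Matrix.unitaryGroup n ℂ => swapMatrix_mul_kronecker U.1 U.1) Z
  simp only [hab, hZ, mul_add, one_mul, Matrix.mul_smul, mul_one, swapMatrix_mul_self,
    Matrix.trace_add, Matrix.trace_smul, Matrix.trace_one, trace_swapMatrix, smul_eq_mul,
    Fintype.card_prod, Nat.cast_mul] at htr hswap
  have hd : (Fintype.card n : ℂ) ≠ 0 := Nat.cast_ne_zero.mpr Fintype.card_ne_zero
  have hd' : (Fintype.card n : ℂ) ^ 2 - 1 ≠ 0 := by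
    exact_mod_cast (card_sq_sub_one_pos n).ne'
  have ha : a = -b * (Fintype.card n : ℂ)⁻¹ := by
    rw [eq_mul_inv_iff_mul_eq₀ hd]
    exact mul_left_cancel₀ hd (by linear_combination htr)
  have hb : b = (swapMatrix n * Z).trace / ((Fintype.card n : ℂ) ^ 2 - 1) := by
    rw [eq_div_iff hd', ← hswap, ha]
    field_simp
    ring
  rw [hab, ha, ← hb]
  module

/-- Trace and complex conjugation turn the integrand into a coefficient of the twirl of
`Y ⊗ Y'ᴴ` by `U ⊗ U`. -/
lemma integral_trace_mul_conj_mul_star [Nontrivial n] (X X' Y' : Matrix n n ℂ) {Y : Matrix n n ℂ}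
    (hY : Y.trace = 0) :
    ∫ U, (X * ((U : Matrix n n ℂ) * Y * (U : Matrix n n ℂ)ᴴ)).trace *
        star (X' * ((U : Matrix n n ℂ) * Y' * (U : Matrix n n ℂ)ᴴ)).trace ∂(unitaryHaar n) =
      ((Y * Y'ᴴ).trace / ((Fintype.card n : ℂ) ^ 2 - 1)) *
        ((X * X'ᴴ).trace - (Fintype.card n : ℂ)⁻¹ * (X.trace * star X'.trace)) := by
  have hcoeff (U : Matrix.unitaryGroup n ℂ) :
      (X * ((U : Matrix n n ℂ) * Y * (U : Matrix n n ℂ)ᴴ)).trace *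
        star (X' * ((U : Matrix n n ℂ) * Y' * (U : Matrix n n ℂ)ᴴ)).trace =
      ((X ⊗ₖ X'ᴴ) * (kroneckerSelf n U * (Y ⊗ₖ Y'ᴴ) * (kroneckerSelf n U)ᴴ)).trace := by
    rw [← Matrix.trace_conjTranspose, Matrix.conjTranspose_mul, Matrix.trace_mul_comm _ X'ᴴ,
      ← Matrix.trace_kronecker]
    simp only [kroneckerSelf, StarMonoidHom.coe_mk, MonoidHom.coe_mk, OneHom.coe_mk,
      Matrix.conjTranspose_kronecker, ← Matrix.mul_kronecker_mul, mul_assoc,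
      Matrix.conjTranspose_mul, Matrix.conjTranspose_conjTranspose]
  have hZ : (Y ⊗ₖ Y'ᴴ).trace = 0 := by rw [Matrix.trace_kronecker, hY, zero_mul]
  simp only [hcoeff]
  rw [← trace_mul_twirl continuous_kroneckerSelf, twirl_kroneckerSelf hZ,
    trace_swapMatrix_mul_kronecker, Matrix.mul_smul, Matrix.trace_smul, mul_sub, Matrix.trace_sub,
    Matrix.trace_mul_comm (X ⊗ₖ X'ᴴ), trace_swapMatrix_mul_kronecker, Matrix.mul_smul, mul_one,
    Matrix.trace_smul, Matrix.trace_kronecker, Matrix.trace_conjTranspose, smul_eq_mul, smul_eq_mul]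

end Twirl

section Blocks

variable {m m' n n' : Type*}

/-- The block of an operator `m' ⊗ n' → m ⊗ n` at basis vectors of `m` and `m'`. -/
def blockFst (M : Matrix (m × n) (m' × n') ℂ) (i : m) (j : m') : Matrix n n' ℂ :=
  M.submatrix (Prod.mk i) (Prod.mk j)

/-- The block of an operator `m' ⊗ n' → m ⊗ n` at basis vectors of `n` and `n'`. -/
def blockSnd (M : Matrix (m × n) (m' × n') ℂ) (p : n) (q : n') : Matrix m m' ℂ :=
  M.submatrix (·, p) (·, q)

lemma ext_blockFst {M N : Matrix (m × n) (m' × n') ℂ}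
    (h : ∀ i j, blockFst M i j = blockFst N i j) : M = N :=
  Matrix.ext fun p q => congrFun₂ (h p.1 q.1) p.2 q.2

lemma ext_blockSnd {M N : Matrix (m × n) (m' × n') ℂ}
    (h : ∀ p q, blockSnd M p q = blockSnd N p q) : M = N :=
  Matrix.ext fun p q => congrFun₂ (h p.2 q.2) p.1 q.1

lemma sum_frobSq_blockFst [Fintype m] [Fintype m'] [Fintype n] [Fintype n']
    (M : Matrix (m × n) (m' × n') ℂ) : ∑ i, ∑ j, frobSq (blockFst M i j) = frobSq M := by
  simp only [frobSq, blockFst, Matrix.submatrix_apply, Fintype.sum_prod_type]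
  exact Finset.sum_congr rfl fun i _ => Finset.sum_comm

lemma sum_frobSq_blockSnd [Fintype m] [Fintype m'] [Fintype n] [Fintype n']
    (M : Matrix (m × n) (m' × n') ℂ) : ∑ p, ∑ q, frobSq (blockSnd M p q) = frobSq M := by
  simp only [frobSq, blockSnd, Matrix.submatrix_apply, Fintype.sum_prod_type_right]
  exact Finset.sum_congr rfl fun i _ => Finset.sum_comm

lemma blockSnd_kronecker (M : Matrix m m' ℂ) (N : Matrix n n' ℂ) (p : n) (q : n') :
    blockSnd (M ⊗ₖ N) p q = N p q • M :=
  Matrix.ext fun _ _ => mul_comm _ _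

lemma traceLeft_eq_sum_blockFst [Fintype m] (M : Matrix (m × n) (m × n) ℂ) :
    traceLeft M = ∑ i, blockFst M i i := by
  ext p q
  rw [Matrix.sum_apply]
  rfl

lemma trace_traceLeft [Fintype m] [Fintype n] (M : Matrix (m × n) (m × n) ℂ) :
    (traceLeft M).trace = M.trace := by
  simp only [traceLeft, Matrix.trace, Matrix.diag, Matrix.of_apply, Fintype.sum_prod_type_right]

lemma blockFst_one_kronecker_conj [Fintype m] [DecidableEq m] [Fintype n] (Q : Matrix n n ℂ)
    (Z : Matrix (m × n) (m × n) ℂ) (i j : m) :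
    blockFst (((1 : Matrix m m ℂ) ⊗ₖ Q) * Z * ((1 : Matrix m m ℂ) ⊗ₖ Q)ᴴ) i j =
      Q * blockFst Z i j * Qᴴ := by
  ext p q
  simp [blockFst, Matrix.mul_apply, Fintype.sum_prod_type, Matrix.one_apply,
    apply_ite (starRingEnd ℂ)]

lemma blockSnd_kronecker_one_conj [Fintype m] [DecidableEq n] [Fintype n] (U : Matrix m m ℂ)
    (Z : Matrix (m × n) (m × n) ℂ) (p q : n) :
    blockSnd ((U ⊗ₖ (1 : Matrix n n ℂ)) * Z * (U ⊗ₖ (1 : Matrix n n ℂ))ᴴ) p q =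
      U * blockSnd Z p q * Uᴴ := by
  ext i j
  simp [blockSnd, Matrix.mul_apply, Fintype.sum_prod_type, Matrix.one_apply,
    apply_ite (starRingEnd ℂ)]

lemma blockSnd_one_kronecker_conj [Fintype m] [DecidableEq m] [Fintype n] (Q : Matrix n n ℂ)
    (Z : Matrix (m × n) (m × n) ℂ) (p q : n) :
    blockSnd (((1 : Matrix m m ℂ) ⊗ₖ Q) * Z * ((1 : Matrix m m ℂ) ⊗ₖ Q)ᴴ) p q =
      ∑ u, ∑ v, (Q p v * star (Q q u)) • blockSnd Z v u := by
  ext i j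
  change blockFst _ i j p q = _
  simp only [blockFst_one_kronecker_conj, Matrix.mul_apply, Matrix.sum_apply, Finset.sum_mul,
    Matrix.smul_apply, smul_eq_mul, Matrix.conjTranspose_apply, mul_right_comm]
  rfl

end Blocks

section Superoperator

variable {A B C R : Type*}

/-- `ampliate` as a linear map: the superoperator `T ⊗ 𝕀`. -/
def leftMap (R : Type*) (T : Matrix A A ℂ →ₗ[ℂ] Matrix B B ℂ) :
    Matrix (A × R) (A × R) ℂ →ₗ[ℂ] Matrix (B × R) (B × R) ℂ where
  toFun := ampliate R T
  map_add' M N := by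
    ext p q
    exact congrFun₂ (map_add T (blockSnd M p.2 q.2) (blockSnd N p.2 q.2)) p.1 q.1
  map_smul' r M := by
    ext p q
    exact congrFun₂ (map_smul T r (blockSnd M p.2 q.2)) p.1 q.1

/-- The superoperator `𝕀 ⊗ T`. -/
def rightMap (R : Type*) (T : Matrix A A ℂ →ₗ[ℂ] Matrix B B ℂ) :
    Matrix (R × A) (R × A) ℂ →ₗ[ℂ] Matrix (R × B) (R × B) ℂ where
  toFun M := Matrix.of fun p q => T (blockFst M p.1 q.1) p.2 q.2
  map_add' M N := by
    ext p q
    exact congrFun₂ (map_add T (blockFst M p.1 q.1) (blockFst N p.1 q.1)) p.2 q.2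
  map_smul' r M := by
    ext p q
    exact congrFun₂ (map_smul T r (blockFst M p.1 q.1)) p.2 q.2

lemma leftMap_add (S T : Matrix A A ℂ →ₗ[ℂ] Matrix B B ℂ) :
    leftMap R (S + T) = leftMap R S + leftMap R T := rfl

lemma leftMap_sub (S T : Matrix A A ℂ →ₗ[ℂ] Matrix B B ℂ) :
    leftMap R (S - T) = leftMap R S - leftMap R T := rfl

lemma blockSnd_leftMap (T : Matrix A A ℂ →ₗ[ℂ] Matrix B B ℂ) (M : Matrix (A × R) (A × R) ℂ)
    (r s : R) : blockSnd (leftMap R T M) r s = T (blockSnd M r s) := rfl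

lemma blockFst_rightMap (T : Matrix A A ℂ →ₗ[ℂ] Matrix B B ℂ) (M : Matrix (R × A) (R × A) ℂ)
    (r s : R) : blockFst (rightMap R T M) r s = T (blockFst M r s) := rfl

lemma leftMap_kronecker (T : Matrix A A ℂ →ₗ[ℂ] Matrix B B ℂ) (M : Matrix A A ℂ)
    (N : Matrix R R ℂ) : leftMap R T (M ⊗ₖ N) = T M ⊗ₖ N := by
  refine ext_blockSnd fun r s => ?_
  rw [blockSnd_leftMap, blockSnd_kronecker, blockSnd_kronecker, map_smul]

lemma rightMap_kronecker (T : Matrix A A ℂ →ₗ[ℂ] Matrix B B ℂ) (M : Matrix R R ℂ)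
    (N : Matrix A A ℂ) : rightMap R T (M ⊗ₖ N) = M ⊗ₖ T N :=
  ext_blockFst fun r s => map_smul T (M r s) N

lemma leftMap_one_kronecker_conj [Fintype A] [DecidableEq A] [Fintype B] [DecidableEq B]
    [Fintype R] (T : Matrix A A ℂ →ₗ[ℂ] Matrix B B ℂ) (Q : Matrix R R ℂ)
    (M : Matrix (A × R) (A × R) ℂ) :
    leftMap R T (((1 : Matrix A A ℂ) ⊗ₖ Q) * M * ((1 : Matrix A A ℂ) ⊗ₖ Q)ᴴ) =
      ((1 : Matrix B B ℂ) ⊗ₖ Q) * leftMap R T M * ((1 : Matrix B B ℂ) ⊗ₖ Q)ᴴ := by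
  refine ext_blockSnd fun r s => ?_
  simp only [blockSnd_leftMap, blockSnd_one_kronecker_conj, map_sum, map_smul]

lemma frobSq_leftMap_le [Fintype A] [Fintype R] {T : Matrix A A ℂ →ₗ[ℂ] Matrix A A ℂ}
    (hT : ∀ Z, frobSq (T Z) ≤ frobSq Z) (M : Matrix (A × R) (A × R) ℂ) :
    frobSq (leftMap R T M) ≤ frobSq M := by
  rw [← sum_frobSq_blockSnd, ← sum_frobSq_blockSnd M]
  gcongr
  simpa only [blockSnd_leftMap] using hT _

lemma frobSq_rightMap_le [Fintype A] [Fintype R] {T : Matrix A A ℂ →ₗ[ℂ] Matrix A A ℂ}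
    (hT : ∀ Z, frobSq (T Z) ≤ frobSq Z) (M : Matrix (R × A) (R × A) ℂ) :
    frobSq (rightMap R T M) ≤ frobSq M := by
  rw [← sum_frobSq_blockFst, ← sum_frobSq_blockFst M]
  gcongr
  simpa only [blockFst_rightMap] using hT _

lemma traceLeft_rightMap [Fintype R] (T : Matrix A A ℂ →ₗ[ℂ] Matrix B B ℂ)
    (M : Matrix (R × A) (R × A) ℂ) : traceLeft (rightMap R T M) = T (traceLeft M) := by
  simp only [traceLeft_eq_sum_blockFst, blockFst_rightMap, map_sum]

/-- The tensor product of two superoperators. -/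
def tensorMap {m n : Type*} (S : Module.End ℂ (Matrix m m ℂ)) (T : Module.End ℂ (Matrix n n ℂ)) :
    Module.End ℂ (Matrix (m × n) (m × n) ℂ) :=
  leftMap n S ∘ₗ rightMap m T

section

variable {m n : Type*} (S S' : Module.End ℂ (Matrix m m ℂ)) (T T' : Module.End ℂ (Matrix n n ℂ))

lemma tensorMap_add_left : tensorMap (S + S') T = tensorMap S T + tensorMap S' T := rfl

lemma tensorMap_sub_left : tensorMap (S - S') T = tensorMap S T - tensorMap S' T := rfl

lemma tensorMap_add_right : tensorMap S (T + T') = tensorMap S T + tensorMap S T' :=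
  LinearMap.comp_add (rightMap m T) (rightMap m T') (leftMap n S)

lemma tensorMap_sub_right : tensorMap S (T - T') = tensorMap S T - tensorMap S T' :=
  LinearMap.comp_sub (rightMap m T') (rightMap m T) (leftMap n S)

lemma tensorMap_add_add : tensorMap (S + S') (T + T') =
    (tensorMap S T + tensorMap S' T') + (tensorMap S T' + tensorMap S' T) := by
  simp only [tensorMap_add_left, tensorMap_add_right]
  abel

lemma tensorMap_sub_sub : tensorMap (S - S') (T - T') =
    (tensorMap S T + tensorMap S' T') - (tensorMap S T' + tensorMap S' T) := by
  simp only [tensorMap_sub_left, tensorMap_sub_right]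
  abel

end

/-- Conjugation by a matrix. -/
def conjMap [Fintype A] (V : Matrix A A ℂ) : Module.End ℂ (Matrix A A ℂ) :=
  LinearMap.mulRight ℂ Vᴴ ∘ₗ LinearMap.mulLeft ℂ V

/-- The completely depolarising superoperator `Z ↦ (Tr Z / |A|) 1`. -/
def depolarize (A : Type*) [Fintype A] [DecidableEq A] : Module.End ℂ (Matrix A A ℂ) :=
  (Fintype.card A : ℂ)⁻¹ • (Matrix.traceLinearMap A ℂ ℂ).smulRight 1

lemma conjMap_apply [Fintype A] (V Z : Matrix A A ℂ) : conjMap V Z = V * Z * Vᴴ := rfl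

lemma leftMap_conjMap [Fintype A] [Fintype R] [DecidableEq R] (V : Matrix A A ℂ) :
    leftMap R (conjMap V) = conjMap (V ⊗ₖ (1 : Matrix R R ℂ)) := by
  ext1 M
  refine ext_blockSnd fun r s => ?_
  rw [blockSnd_leftMap, conjMap_apply, conjMap_apply, blockSnd_kronecker_one_conj]

lemma rightMap_conjMap [Fintype A] [Fintype R] [DecidableEq R] (V : Matrix A A ℂ) :
    rightMap R (conjMap V) = conjMap ((1 : Matrix R R ℂ) ⊗ₖ V) := by
  ext1 M
  refine ext_blockFst fun r s => ?_
  rw [blockFst_rightMap, conjMap_apply, conjMap_apply, blockFst_one_kronecker_conj]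

lemma conjMap_mul [Fintype A] (V W : Matrix A A ℂ) :
    conjMap (V * W) = conjMap V ∘ₗ conjMap W := by
  ext1 M
  simp only [LinearMap.comp_apply, conjMap_apply, Matrix.conjTranspose_mul, mul_assoc]

lemma tensorMap_conjMap [Fintype A] [Fintype B] (V : Matrix A A ℂ) (W : Matrix B B ℂ) :
    tensorMap (conjMap V) (conjMap W) = conjMap (V ⊗ₖ W) := by
  classical
  rw [tensorMap, leftMap_conjMap, rightMap_conjMap, ← conjMap_mul, ← Matrix.mul_kronecker_mul,
    mul_one, one_mul]

variable [Fintype A] [DecidableEq A]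

lemma depolarize_apply (Z : Matrix A A ℂ) :
    depolarize A Z = ((Fintype.card A : ℂ)⁻¹ * Z.trace) • 1 := by
  rw [depolarize, LinearMap.smul_apply, LinearMap.smulRight_apply, Matrix.traceLinearMap_apply,
    smul_smul]

lemma leftMap_depolarize (M : Matrix (A × R) (A × R) ℂ) :
    leftMap R (depolarize A) M =
      (Fintype.card A : ℂ)⁻¹ • ((1 : Matrix A A ℂ) ⊗ₖ traceLeft M) := by
  refine ext_blockSnd fun r s => ?_
  rw [blockSnd_leftMap, depolarize_apply]
  rw [← Matrix.kronecker_smul, blockSnd_kronecker]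
  rfl

lemma tensorMap_depolarize [Fintype B] [DecidableEq B] :
    tensorMap (depolarize A) (depolarize B) = depolarize (A × B) := by
  ext1 M
  simp only [tensorMap, LinearMap.comp_apply, leftMap_depolarize, traceLeft_rightMap,
    depolarize_apply, trace_traceLeft, Matrix.kronecker_smul, Matrix.one_kronecker_one, smul_smul,
    Fintype.card_prod, Nat.cast_mul, mul_inv, mul_assoc]

end Superoperator

section CompletelyPositive

variable {A B C R : Type*}

lemma posSemidef_traceLeft [Fintype A] {M : Matrix (A × B) (A × B) ℂ} (hM : M.PosSemidef) :
    (traceLeft M).PosSemidef := by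
  rw [traceLeft_eq_sum_blockFst]
  exact Matrix.posSemidef_sum _ fun i _ => hM.submatrix _

namespace IsCompletelyPositive

lemma posSemidef_leftMap [Finite R] {T : Matrix A A ℂ →ₗ[ℂ] Matrix B B ℂ}
    (hT : IsCompletelyPositive T) {M : Matrix (A × R) (A × R) ℂ} (hM : M.PosSemidef) :
    (leftMap R T M).PosSemidef := by
  obtain ⟨k, ⟨e⟩⟩ := Finite.exists_equiv_fin R
  convert (hT _ _ (hM.submatrix (Prod.map id e.symm))).submatrix (Prod.map id e) using 1
  refine Matrix.ext fun p q => congrFun₂ (congrArg T (Matrix.ext fun a a' => ?_)) p.1 q.1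
  simp only [Matrix.of_apply, Prod.map_apply, Prod.map_snd, id_eq, Matrix.submatrix_apply,
    e.symm_apply_apply]

lemma isHermitian_leftMap [Finite A] [Finite R] {T : Matrix A A ℂ →ₗ[ℂ] Matrix B B ℂ}
    (hT : IsCompletelyPositive T) {M : Matrix (A × R) (A × R) ℂ} (hM : M.IsHermitian) :
    (leftMap R T M).IsHermitian := by
  classical
  have := Fintype.ofFinite A
  have := Fintype.ofFinite R
  obtain ⟨P, N, hP, hN, rfl, -⟩ := exists_sub_posSemidef hM
  rw [map_sub]
  exact (hT.posSemidef_leftMap hP).isHermitian.sub (hT.posSemidef_leftMap hN).isHermitian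

lemma add {S T : Matrix A A ℂ →ₗ[ℂ] Matrix B B ℂ} (hS : IsCompletelyPositive S)
    (hT : IsCompletelyPositive T) : IsCompletelyPositive (S + T) :=
  fun k M hM => (hS k M hM).add (hT k M hM)

lemma comp {S : Matrix B B ℂ →ₗ[ℂ] Matrix C C ℂ} {T : Matrix A A ℂ →ₗ[ℂ] Matrix B B ℂ}
    (hS : IsCompletelyPositive S) (hT : IsCompletelyPositive T) : IsCompletelyPositive (S ∘ₗ T) :=
  fun k M hM => hS k _ (hT k M hM)

protected lemma conjMap [Fintype A] (V : Matrix A A ℂ) : IsCompletelyPositive (conjMap V) := by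
  intro k M hM
  change (leftMap (Fin k) (Decoupling.conjMap V) M).PosSemidef
  rw [leftMap_conjMap]
  exact hM.mul_mul_conjTranspose_same _

protected lemma depolarize [Fintype A] [DecidableEq A] : IsCompletelyPositive (depolarize A) := by
  intro k M hM
  change (leftMap (Fin k) (Decoupling.depolarize A) M).PosSemidef
  rw [leftMap_depolarize]
  exact (Matrix.PosSemidef.one.kronecker (posSemidef_traceLeft hM)).smul
    (inv_nonneg.mpr (Nat.cast_nonneg _))

protected lemma leftMap [Finite R] {T : Matrix A A ℂ →ₗ[ℂ] Matrix B B ℂ}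
    (hT : IsCompletelyPositive T) : IsCompletelyPositive (leftMap R T) := fun k _ hM =>
  (hT.posSemidef_leftMap (R := R × Fin k)
    (hM.submatrix fun p : A × R × Fin k => ((p.1, p.2.1), p.2.2))).submatrix
      fun p : (B × R) × Fin k => (p.1.1, (p.1.2, p.2))

protected lemma rightMap [Finite R] {T : Matrix A A ℂ →ₗ[ℂ] Matrix B B ℂ}
    (hT : IsCompletelyPositive T) : IsCompletelyPositive (rightMap R T) := fun k _ hM =>
  (hT.posSemidef_leftMap (R := R × Fin k)
    (hM.submatrix fun p : A × R × Fin k => ((p.2.1, p.1), p.2.2))).submatrix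
      fun p : (R × B) × Fin k => (p.1.2, (p.1.1, p.2))

protected lemma tensorMap [Finite A] [Finite B] {S : Module.End ℂ (Matrix A A ℂ)}
    {T : Module.End ℂ (Matrix B B ℂ)} (hS : IsCompletelyPositive S) (hT : IsCompletelyPositive T) :
    IsCompletelyPositive (tensorMap S T) :=
  hS.leftMap.comp hT.rightMap

end IsCompletelyPositive

end CompletelyPositive

section Center

variable {n : Type*} [Fintype n] [DecidableEq n]

/-- The projection of operators onto the traceless ones, the complement of `depolarize`. -/
def center (n : Type*) [Fintype n] [DecidableEq n] : Module.End ℂ (Matrix n n ℂ) :=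
  LinearMap.id - depolarize n

variable [Nonempty n]

lemma trace_depolarize (Z : Matrix n n ℂ) : (depolarize n Z).trace = Z.trace := by
  rw [depolarize_apply, Matrix.trace_smul, Matrix.trace_one, smul_eq_mul, mul_right_comm,
    inv_mul_cancel₀ (Nat.cast_ne_zero.mpr Fintype.card_ne_zero), one_mul]

lemma trace_center (Z : Matrix n n ℂ) : (center n Z).trace = 0 := by
  rw [center, LinearMap.sub_apply, LinearMap.id_apply, Matrix.trace_sub, trace_depolarize, sub_self]

lemma trace_center_mul_conjTranspose (X Y : Matrix n n ℂ) :
    (center n X * (center n Y)ᴴ).trace =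
      (X * Yᴴ).trace - (Fintype.card n : ℂ)⁻¹ * (X.trace * star Y.trace) := by
  have horth : (depolarize n X * (center n Y)ᴴ).trace = 0 := by
    rw [depolarize_apply, Matrix.smul_mul, one_mul, Matrix.trace_smul, Matrix.trace_conjTranspose,
      trace_center, star_zero, smul_zero]
  calc (center n X * (center n Y)ᴴ).trace
      = (X * (center n Y)ᴴ).trace := by
        rw [center, LinearMap.sub_apply, sub_mul, Matrix.trace_sub, ← center, horth, sub_zero,
          LinearMap.id_apply]
    _ = (X * Yᴴ).trace - (Fintype.card n : ℂ)⁻¹ * (X.trace * star Y.trace) := by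
        rw [center, LinearMap.sub_apply, LinearMap.id_apply, Matrix.conjTranspose_sub, mul_sub,
          Matrix.trace_sub, depolarize_apply, Matrix.conjTranspose_smul, Matrix.conjTranspose_one,
          Matrix.mul_smul, mul_one, Matrix.trace_smul, smul_eq_mul, star_mul', star_inv₀,
          star_natCast, mul_assoc, mul_comm (star _)]

lemma frobSq_center_le (Z : Matrix n n ℂ) : frobSq (center n Z) ≤ frobSq Z := by
  have h : frobSq (center n Z) = frobSq Z - (Fintype.card n : ℝ)⁻¹ * ‖Z.trace‖ ^ 2 := by
    rw [← Complex.ofReal_inj, ← trace_mul_conjTranspose, trace_center_mul_conjTranspose,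
      trace_mul_conjTranspose, Complex.star_def, Complex.mul_conj']
    push_cast
    rfl
  rw [h]
  exact sub_le_self _ (by positivity)

end Center

section SecondMoment

variable {n : Type*} [Fintype n] [DecidableEq n]

lemma frobSq_sum_kronecker {ι m m' k k' : Type*} [Fintype ι] [Fintype m] [Fintype m'] [Fintype k]
    [Fintype k'] (X : ι → Matrix m m' ℂ) (Y : ι → Matrix k k' ℂ) :
    (frobSq (∑ i, X i ⊗ₖ Y i) : ℂ) =
      ∑ i, ∑ j, (X i * (X j)ᴴ).trace * (Y i * (Y j)ᴴ).trace := by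
  simp only [← trace_mul_conjTranspose, Matrix.conjTranspose_sum, Matrix.sum_mul, Matrix.mul_sum,
    Matrix.conjTranspose_kronecker, ← Matrix.mul_kronecker_mul, Matrix.trace_sum,
    Matrix.trace_kronecker]
  exact Finset.sum_comm

lemma continuous_trace_mul_conj (X Y : Matrix n n ℂ) :
    Continuous fun U : Matrix.unitaryGroup n ℂ =>
      (X * ((U : Matrix n n ℂ) * Y * (U : Matrix n n ℂ)ᴴ)).trace :=
  have hU : Continuous fun U : Matrix.unitaryGroup n ℂ => (U : Matrix n n ℂ) :=
    continuous_subtype_val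
  (continuous_const.matrix_mul
    ((hU.matrix_mul continuous_const).matrix_mul hU.matrix_conjTranspose)).matrix_trace

lemma integral_sq_norm_sum_trace [Nontrivial n] {ι : Type*} [Fintype ι] (X Y : ι → Matrix n n ℂ)
    (hY : ∀ i, (Y i).trace = 0) :
    ∫ U, ‖∑ i, (X i * ((U : Matrix n n ℂ) * Y i * (U : Matrix n n ℂ)ᴴ)).trace‖ ^ 2
        ∂(unitaryHaar n) =
      ((Fintype.card n : ℝ) ^ 2 - 1)⁻¹ * frobSq (∑ i, center n (X i) ⊗ₖ Y i) := by
  have hint (i j : ι) : Integrable (fun U : Matrix.unitaryGroup n ℂ =>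
      (X i * ((U : Matrix n n ℂ) * Y i * (U : Matrix n n ℂ)ᴴ)).trace *
        star (X j * ((U : Matrix n n ℂ) * Y j * (U : Matrix n n ℂ)ᴴ)).trace) (unitaryHaar n) :=
    integrable_of_continuous _
      ((continuous_trace_mul_conj (X i) (Y i)).mul (continuous_trace_mul_conj (X j) (Y j)).star)
  rw [← Complex.ofReal_inj, ← integral_complex_ofReal, Complex.ofReal_mul, frobSq_sum_kronecker]
  simp only [Complex.ofReal_pow, ← Complex.mul_conj', ← Complex.star_def, star_sum,
    Finset.sum_mul_sum, trace_center_mul_conjTranspose]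
  rw [integral_finsetSum _ fun i _ => integrable_finsetSum _ fun j _ => hint i j, Finset.mul_sum]
  refine Finset.sum_congr rfl fun i _ => ?_
  rw [integral_finsetSum _ fun j _ => hint i j, Finset.mul_sum]
  refine Finset.sum_congr rfl fun j _ => ?_
  rw [integral_trace_mul_conj_mul_star (X i) (X j) (Y j) (hY i)]
  push_cast
  ring

lemma trace_mul_kronecker {k k' l l' : Type*} [Fintype k] [Fintype k'] [Fintype l] [Fintype l']
    (K : Matrix (k' × l') (k × l) ℂ) (F : Matrix k k' ℂ) (G : Matrix l l' ℂ) :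
    (K * (F ⊗ₖ G)).trace = (Matrix.of (fun p q => (blockSnd K p q * F).trace) * G).trace := by
  simp only [Matrix.trace, Matrix.diag, Matrix.mul_apply, Matrix.of_apply, blockSnd,
    Matrix.submatrix_apply, Matrix.kroneckerMap_apply, Fintype.sum_prod_type_right, Finset.sum_mul,
    mul_assoc]
  exact Finset.sum_congr rfl fun p _ => Finset.sum_comm

section

variable {Ω Ω' : Type*} [TopologicalSpace Ω] [CompactSpace Ω] [MeasurableSpace Ω]
  [OpensMeasurableSpace Ω] {μ : Measure Ω} [IsFiniteMeasure μ] [TopologicalSpace Ω']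
  [CompactSpace Ω'] [MeasurableSpace Ω'] [OpensMeasurableSpace Ω']
  [SecondCountableTopologyEither Ω Ω'] {ν : Measure Ω'} [IsFiniteMeasure ν]
  {k k' l l' : Type*} [Fintype k] [Fintype k'] [Fintype l] [Fintype l']

lemma integral_frobSq {F : Ω → Matrix k l ℂ} (hF : Continuous F) :
    ∫ ω, frobSq (F ω) ∂μ = ∑ i, ∑ j, ∫ ω, ‖F ω i j‖ ^ 2 ∂μ := by
  have hint (i : k) (j : l) : Integrable (fun ω => ‖F ω i j‖ ^ 2) μ :=
    integrable_of_continuous μ ((hF.matrix_elem i j).norm.pow 2)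
  simp only [frobSq]
  rw [integral_finsetSum _ fun i _ => integrable_finsetSum _ fun j _ => hint i j]
  exact Finset.sum_congr rfl fun i _ => integral_finsetSum _ fun j _ => hint i j

lemma integral_sq_norm_trace_mul_kronecker_le {F : Ω → Matrix k k' ℂ} {G : Ω' → Matrix l l' ℂ}
    (hF : Continuous F) (hG : Continuous G) {a b : ℝ} (hb : 0 ≤ b)
    (hFa : ∀ K : Matrix k' k ℂ, ∫ ω, ‖(K * F ω).trace‖ ^ 2 ∂μ ≤ a * frobSq K)
    (hGb : ∀ K : Matrix l' l ℂ, ∫ ω, ‖(K * G ω).trace‖ ^ 2 ∂ν ≤ b * frobSq K)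
    (K : Matrix (k' × l') (k × l) ℂ) :
    ∫ ω, ‖(K * (F ω.1 ⊗ₖ G ω.2)).trace‖ ^ 2 ∂(μ.prod ν) ≤ a * b * frobSq K := by
  let KF (ω : Ω) : Matrix l' l ℂ := Matrix.of fun p q => (blockSnd K p q * F ω).trace
  have hKF : Continuous KF :=
    continuous_matrix fun p q => (continuous_const.matrix_mul hF).matrix_trace
  have hcont : Continuous fun ω : Ω × Ω' => ‖(KF ω.1 * G ω.2).trace‖ ^ 2 :=
    ((hKF.comp continuous_fst).matrix_mul (hG.comp continuous_snd)).matrix_trace.norm.pow 2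
  have hint := integrable_of_continuous (μ.prod ν) hcont
  have hfrob : ∫ ω, frobSq (KF ω) ∂μ ≤ a * frobSq K := by
    rw [integral_frobSq hKF, ← sum_frobSq_blockSnd K]
    simp only [Finset.mul_sum]
    exact Finset.sum_le_sum fun p _ => Finset.sum_le_sum fun q _ => hFa _
  simp only [trace_mul_kronecker]
  rw [integral_prod _ hint]
  calc ∫ ω, ∫ ω', ‖(KF ω * G ω').trace‖ ^ 2 ∂ν ∂μ
      ≤ ∫ ω, b * frobSq (KF ω) ∂μ :=
        integral_mono hint.integral_prod_left
          (integrable_of_continuous μ ((continuous_frobSq.comp hKF).const_mul b)) fun ω => hGb _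
    _ ≤ a * b * frobSq K := by
        rw [integral_const_mul, mul_comm a b, mul_assoc]
        exact mul_le_mul_of_nonneg_left hfrob hb

end

end SecondMoment

section Transfer

lemma trace_mul_submatrix_equiv {A B : Type*} [Fintype A] [Fintype B] (K : Matrix A A ℂ)
    (N : Matrix B B ℂ) (e : A ≃ B) :
    (K * N.submatrix e e).trace = (K.submatrix e.symm e.symm * N).trace := by
  simp only [Matrix.trace, Matrix.diag, Matrix.mul_apply, Matrix.submatrix_apply]
  rw [← e.sum_comp]
  refine Finset.sum_congr rfl fun i _ => ?_
  rw [← e.sum_comp]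
  simp only [e.symm_apply_apply]

variable {A B C : Type*} [DecidableEq A] [DecidableEq C]

/-- The matrix of a superoperator in the bases of matrix units: the row `(i, j)` and the column
`(k, l)` hold the coefficient of the unit `E i j` in the image of `E k l`. -/
def transfer (Φ : Matrix A A ℂ →ₗ[ℂ] Matrix B B ℂ) : Matrix (B × B) (A × A) ℂ :=
  Matrix.of fun s t => Φ (Matrix.single t.1 t.2 1) s.1 s.2

lemma transfer_add (Φ Ψ : Matrix A A ℂ →ₗ[ℂ] Matrix B B ℂ) :
    transfer (Φ + Ψ) = transfer Φ + transfer Ψ := rfl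

lemma map_apply_eq_sum_transfer [Fintype A] (Φ : Matrix A A ℂ →ₗ[ℂ] Matrix B B ℂ)
    (Z : Matrix A A ℂ) (i j : B) : Φ Z i j = ∑ t, transfer Φ (i, j) t * Z t.1 t.2 := by
  conv_lhs => rw [Matrix.matrix_eq_sum_single Z]
  simp only [map_sum, Matrix.sum_apply, Fintype.sum_prod_type, transfer, Matrix.of_apply]
  refine Finset.sum_congr rfl fun k _ => Finset.sum_congr rfl fun l _ => ?_
  rw [← mul_one (Z k l), ← smul_eq_mul, ← Matrix.smul_single, map_smul, Matrix.smul_apply,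
    smul_eq_mul, smul_eq_mul, mul_one, mul_comm]

lemma trace_mul_transfer [Fintype A] [Fintype B] (K : Matrix (A × A) (B × B) ℂ)
    (Φ : Matrix A A ℂ →ₗ[ℂ] Matrix B B ℂ) :
    (K * transfer Φ).trace =
      ∑ t, (Matrix.of (fun i j => K t (j, i)) * Φ (Matrix.single t.1 t.2 1)).trace := by
  simp only [Matrix.trace, Matrix.diag, Matrix.mul_apply, transfer, Matrix.of_apply]
  exact Finset.sum_congr rfl fun _ _ => Fintype.sum_prod_type_right _

lemma frobSq_sum_kronecker_single [Fintype A] [Fintype B] (K : Matrix (A × A) (B × B) ℂ) :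
    frobSq (∑ t, Matrix.of (fun i j => K t (j, i)) ⊗ₖ Matrix.single t.1 t.2 (1 : ℂ)) =
      frobSq K := by
  have hblock (k l : A) :
      blockSnd (∑ t, Matrix.of (fun i j => K t (j, i)) ⊗ₖ Matrix.single t.1 t.2 (1 : ℂ)) k l =
        Matrix.of fun i j => K (k, l) (j, i) := by
    ext i j
    simp [blockSnd, Matrix.sum_apply, Fintype.sum_prod_type, Matrix.single_apply,
      ite_and]
  rw [← sum_frobSq_blockSnd]
  simp_rw [hblock]
  simp only [frobSq, Matrix.of_apply, Fintype.sum_prod_type]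
  exact Finset.sum_congr rfl fun k _ => Finset.sum_congr rfl fun l _ => Finset.sum_comm

lemma transfer_tensorMap (Φ : Module.End ℂ (Matrix A A ℂ)) (Ψ : Module.End ℂ (Matrix C C ℂ)) :
    transfer (tensorMap Φ Ψ) = (transfer Φ ⊗ₖ transfer Ψ).submatrix
      (Equiv.prodProdProdComm A C A C) (Equiv.prodProdProdComm A C A C) := by
  ext s t
  have hsingle : Matrix.single t.1 t.2 (1 : ℂ) =
      Matrix.single t.1.1 t.2.1 1 ⊗ₖ Matrix.single t.1.2 t.2.2 1 := by
    rw [Matrix.single_kronecker_single, mul_one]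
  simp only [transfer, Matrix.of_apply, hsingle, tensorMap, LinearMap.comp_apply,
    rightMap_kronecker, leftMap_kronecker]
  rfl

end Transfer

section UnitaryFluctuation

variable {n : Type*} [Fintype n]

variable (n) in
lemma one_sub_inv_sq_card_nonneg : 0 ≤ 1 - ((Fintype.card n : ℝ) ^ 2)⁻¹ :=
  sub_nonneg.mpr (by exact_mod_cast Nat.cast_inv_le_one (Fintype.card n ^ 2))

variable (n) in
lemma dimFactor_nonneg : 0 ≤ dimFactor n :=
  Real.rpow_nonneg (one_sub_inv_sq_card_nonneg n) _

lemma sq_dimFactor_div_card [Nontrivial n] :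
    (dimFactor n / Fintype.card n) ^ 2 = ((Fintype.card n : ℝ) ^ 2 - 1)⁻¹ := by
  have hsq : dimFactor n ^ 2 = (1 - ((Fintype.card n : ℝ) ^ 2)⁻¹)⁻¹ := by
    rw [dimFactor, ← Real.rpow_mul_natCast (one_sub_inv_sq_card_nonneg n), ← Real.rpow_neg_one]
    norm_num [Real.rpow_neg_one]
  rw [div_pow, hsq, div_eq_mul_inv, ← mul_inv, sub_mul, one_mul,
    inv_mul_cancel₀ (by positivity)]

variable [DecidableEq n]

lemma conjMap_sub_depolarize_apply (U : Matrix.unitaryGroup n ℂ) (Z : Matrix n n ℂ) :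
    (conjMap (U : Matrix n n ℂ) - depolarize n) Z =
      (U : Matrix n n ℂ) * center n Z * (U : Matrix n n ℂ)ᴴ := by
  rw [center, LinearMap.sub_apply, LinearMap.sub_apply, conjMap_apply, LinearMap.id_apply, mul_sub,
    sub_mul, depolarize_apply, Matrix.mul_smul, mul_one, Matrix.smul_mul,
    ← Matrix.star_eq_conjTranspose, Unitary.mul_star_self_of_mem U.2]

lemma integral_sq_norm_trace_mul_transfer_le [Nontrivial n] (K : Matrix (n × n) (n × n) ℂ) :
    ∫ U, ‖(K * transfer (conjMap (U : Matrix n n ℂ) - depolarize n)).trace‖ ^ 2 ∂(unitaryHaar n) ≤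
      (dimFactor n / Fintype.card n) ^ 2 * frobSq K := by
  simp only [trace_mul_transfer, conjMap_sub_depolarize_apply]
  rw [integral_sq_norm_sum_trace _ _ fun _ => trace_center _, sq_dimFactor_div_card]
  have hcenter (X Y : n × n → Matrix n n ℂ) : ∑ t, center n (X t) ⊗ₖ center n (Y t) =
      leftMap n (center n) (rightMap n (center n) (∑ t, X t ⊗ₖ Y t)) := by
    simp only [map_sum, rightMap_kronecker, leftMap_kronecker]
  gcongr
  · exact (inv_pos.mpr (card_sq_sub_one_pos n)).le
  rw [hcenter, ← frobSq_sum_kronecker_single K]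
  exact (frobSq_leftMap_le frobSq_center_le _).trans (frobSq_rightMap_le frobSq_center_le _)

end UnitaryFluctuation

section DecouplingFamily

lemma continuous_transfer_tensorMap {Ω Ω' A B : Type*} [TopologicalSpace Ω] [TopologicalSpace Ω']
    [DecidableEq A] [DecidableEq B] {L : Ω → Module.End ℂ (Matrix A A ℂ)}
    {M : Ω' → Module.End ℂ (Matrix B B ℂ)}
    (hL : Continuous fun ω => transfer (L ω)) (hM : Continuous fun ω => transfer (M ω)) :
    Continuous fun ω : Ω × Ω' => transfer (tensorMap (L ω.1) (M ω.2)) := by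
  simp only [transfer_tensorMap]
  exact continuous_matrix fun s t => ((hL.comp continuous_fst).matrix_elem _ _).mul
    ((hM.comp continuous_snd).matrix_elem _ _)

variable {Ω Ω' A B : Type*} [TopologicalSpace Ω] [MeasurableSpace Ω] [TopologicalSpace Ω']
  [MeasurableSpace Ω'] [Fintype A] [DecidableEq A] [Fintype B] [DecidableEq B]

/-- The difference `L ω - L' ω` of two random completely positive superoperators fluctuates like
a random unitary conjugation around its mean, up to a factor `κ`, and the superoperators add up to
`c` times the completely depolarising one on average. -/
structure IsDecouplingFamily (μ : Measure Ω) (L L' : Ω → Module.End ℂ (Matrix A A ℂ))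
    (c κ : ℝ) : Prop where
  continuous_left : Continuous fun ω => transfer (L ω)
  continuous_right : Continuous fun ω => transfer (L' ω)
  isCompletelyPositive_left : ∀ ω, IsCompletelyPositive (L ω)
  isCompletelyPositive_right : ∀ ω, IsCompletelyPositive (L' ω)
  scale_nonneg : 0 ≤ c
  factor_nonneg : 0 ≤ κ
  integral_transfer_add : ∀ s t,
    ∫ ω, transfer (L ω + L' ω) s t ∂μ = c * transfer (depolarize A) s t
  integral_sq_norm_trace_mul_transfer_sub_le : ∀ K : Matrix (A × A) (A × A) ℂ,
    ∫ ω, ‖(K * transfer (L ω - L' ω)).trace‖ ^ 2 ∂μ ≤ (κ / Fintype.card A) ^ 2 * frobSq K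

namespace IsDecouplingFamily

lemma unitaryHaar [Nontrivial A] : IsDecouplingFamily (unitaryHaar A)
    (fun U => conjMap (U : Matrix A A ℂ)) (fun _ => depolarize A) 2 (dimFactor A) where
  continuous_left := continuous_matrix fun s t =>
    ((continuous_subtype_val.matrix_mul continuous_const).matrix_mul
      continuous_subtype_val.matrix_conjTranspose).matrix_elem s.1 s.2
  continuous_right := continuous_const
  isCompletelyPositive_left U := .conjMap _
  isCompletelyPositive_right _ := .depolarize
  scale_nonneg := zero_le_two
  factor_nonneg := dimFactor_nonneg A
  integral_transfer_add s t := by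
    have htwirl : ∫ U, transfer (conjMap (U : Matrix A A ℂ)) s t ∂(Decoupling.unitaryHaar A) =
        transfer (depolarize A) s t := by
      refine (congrFun₂ (twirl_id (Matrix.single t.1 t.2 (1 : ℂ))) s.1 s.2).trans ?_
      rw [div_eq_inv_mul, ← depolarize_apply]
      rfl
    have hint : Integrable (fun U : Matrix.unitaryGroup A ℂ =>
        transfer (conjMap (U : Matrix A A ℂ)) s t) (Decoupling.unitaryHaar A) :=
      integrable_map_conj (π := .id _) continuous_id _ s.1 s.2
    simp only [transfer_add, Matrix.add_apply]
    rw [integral_add hint (integrable_const _), htwirl, integral_const, probReal_univ, one_smul,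
      Complex.ofReal_ofNat, two_mul]
  integral_sq_norm_trace_mul_transfer_sub_le := integral_sq_norm_trace_mul_transfer_le

lemma tensor [CompactSpace Ω] [CompactSpace Ω'] [OpensMeasurableSpace Ω] [OpensMeasurableSpace Ω']
    [SecondCountableTopologyEither Ω Ω'] {μ : Measure Ω} [IsFiniteMeasure μ] {ν : Measure Ω'}
    [IsFiniteMeasure ν] {L L' : Ω → Module.End ℂ (Matrix A A ℂ)}
    {M M' : Ω' → Module.End ℂ (Matrix B B ℂ)} {c c' κ κ' : ℝ}
    (hL : IsDecouplingFamily μ L L' c κ) (hM : IsDecouplingFamily ν M M' c' κ') :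
    IsDecouplingFamily (μ.prod ν)
      (fun ω => tensorMap (L ω.1) (M ω.2) + tensorMap (L' ω.1) (M' ω.2))
      (fun ω => tensorMap (L ω.1) (M' ω.2) + tensorMap (L' ω.1) (M ω.2)) (c * c') (κ * κ') where
  continuous_left := (continuous_transfer_tensorMap hL.continuous_left hM.continuous_left).add
    (continuous_transfer_tensorMap hL.continuous_right hM.continuous_right)
  continuous_right := (continuous_transfer_tensorMap hL.continuous_left hM.continuous_right).add
    (continuous_transfer_tensorMap hL.continuous_right hM.continuous_left)
  isCompletelyPositive_left ω :=
    ((hL.isCompletelyPositive_left ω.1).tensorMap (hM.isCompletelyPositive_left ω.2)).add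
      ((hL.isCompletelyPositive_right ω.1).tensorMap (hM.isCompletelyPositive_right ω.2))
  isCompletelyPositive_right ω :=
    ((hL.isCompletelyPositive_left ω.1).tensorMap (hM.isCompletelyPositive_right ω.2)).add
      ((hL.isCompletelyPositive_right ω.1).tensorMap (hM.isCompletelyPositive_left ω.2))
  scale_nonneg := mul_nonneg hL.scale_nonneg hM.scale_nonneg
  factor_nonneg := mul_nonneg hL.factor_nonneg hM.factor_nonneg
  integral_transfer_add s t := by
    simp only [← tensorMap_add_add, ← tensorMap_depolarize, transfer_tensorMap,
      Matrix.submatrix_apply, Matrix.kroneckerMap_apply]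
    rw [integral_prod_mul (fun ω => transfer (L ω + L' ω) _ _)
      (fun ω => transfer (M ω + M' ω) _ _), hL.integral_transfer_add, hM.integral_transfer_add]
    push_cast
    ring
  integral_sq_norm_trace_mul_transfer_sub_le K := by
    simp only [← tensorMap_sub_sub, transfer_tensorMap, trace_mul_submatrix_equiv]
    refine (integral_sq_norm_trace_mul_kronecker_le (hL.continuous_left.sub hL.continuous_right)
      (hM.continuous_left.sub hM.continuous_right) (sq_nonneg _)
      hL.integral_sq_norm_trace_mul_transfer_sub_le
      hM.integral_sq_norm_trace_mul_transfer_sub_le _).trans_eq ?_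
    rw [frobSq_submatrix_equiv, Fintype.card_prod, ← mul_pow, div_mul_div_comm, Nat.cast_mul]

end IsDecouplingFamily

end DecouplingFamily

section Contract

variable {A B R : Type*} [Fintype A]

/-- The output `|A| ∑ X_{aa'} ⊗ Y_{aa'}` of the superoperator with Choi matrix `X` applied to the
`A`-part of `Y`, as a bilinear map. -/
def contract : Matrix (A × B) (A × B) ℂ →ₗ[ℂ] Matrix (A × R) (A × R) ℂ →ₗ[ℂ]
    Matrix (B × R) (B × R) ℂ :=
  LinearMap.mk₂ ℂ
    (fun X Y => (Fintype.card A : ℂ) • ∑ a, ∑ a', blockFst X a a' ⊗ₖ blockFst Y a a')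
    (fun X X' Y => by
      simp only [← smul_add, ← Finset.sum_add_distrib, ← Matrix.add_kronecker]
      rfl)
    (fun c X Y => by
      rw [smul_comm]
      simp only [Finset.smul_sum, ← Matrix.smul_kronecker]
      rfl)
    (fun X Y Y' => by
      simp only [← smul_add, ← Finset.sum_add_distrib, ← Matrix.kronecker_add]
      rfl)
    (fun c X Y => by
      rw [smul_comm]
      simp only [Finset.smul_sum, ← Matrix.kronecker_smul]
      rfl)

lemma contract_eq (X : Matrix (A × B) (A × B) ℂ) (Y : Matrix (A × R) (A × R) ℂ) :
    contract X Y = (Fintype.card A : ℂ) • ∑ a, ∑ a', blockFst X a a' ⊗ₖ blockFst Y a a' := rfl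

lemma contract_apply (X : Matrix (A × B) (A × B) ℂ) (Y : Matrix (A × R) (A × R) ℂ)
    (p q : B × R) : contract X Y p q =
      Fintype.card A * ∑ a, ∑ a', X (a, p.1) (a', q.1) * Y (a, p.2) (a', q.2) := by
  simp only [contract_eq, Matrix.smul_apply, Matrix.sum_apply, Matrix.kroneckerMap_apply, blockFst,
    Matrix.submatrix_apply, smul_eq_mul]

lemma isHermitian_contract {X : Matrix (A × B) (A × B) ℂ} {Y : Matrix (A × R) (A × R) ℂ}
    (hX : X.IsHermitian) (hY : Y.IsHermitian) : (contract X Y).IsHermitian := by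
  ext p q
  rw [Matrix.conjTranspose_apply, contract_apply, contract_apply, Finset.sum_comm]
  simp only [star_mul', star_sum, hX.apply, hY.apply, star_natCast]

lemma posSemidef_contract [Finite B] [Finite R] {X : Matrix (A × B) (A × B) ℂ}
    {Y : Matrix (A × R) (A × R) ℂ} (hX : X.PosSemidef) (hY : Y.PosSemidef) :
    (contract X Y).PosSemidef := by
  classical
  have := Fintype.ofFinite B
  have := Fintype.ofFinite R
  let E : Matrix ((A × B) × (A × R)) (B × R) ℂ := Matrix.of fun p q =>
    if p.1.1 = p.2.1 then if p.1.2 = q.1 then if p.2.2 = q.2 then 1 else 0 else 0 else 0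
  have h : contract X Y = (Fintype.card A : ℂ) • (Eᴴ * (X ⊗ₖ Y) * E) := by
    ext p q
    rw [contract_apply, Finset.sum_comm]
    simp [E, Matrix.mul_apply, Fintype.sum_prod_type, apply_ite (starRingEnd ℂ)]
  rw [h]
  exact ((hX.kronecker hY).conjTranspose_mul_mul_same E).smul (Nat.cast_nonneg _)

lemma contract_conj [DecidableEq A] [Fintype B] [Fintype R] (X : Matrix (A × B) (A × B) ℂ)
    (Y : Matrix (A × R) (A × R) ℂ) (Q : Matrix B B ℂ) (Q' : Matrix R R ℂ) :
    contract (((1 : Matrix A A ℂ) ⊗ₖ Q) * X * ((1 : Matrix A A ℂ) ⊗ₖ Q)ᴴ)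
      (((1 : Matrix A A ℂ) ⊗ₖ Q') * Y * ((1 : Matrix A A ℂ) ⊗ₖ Q')ᴴ) =
      (Q ⊗ₖ Q') * contract X Y * (Q ⊗ₖ Q')ᴴ := by
  rw [Matrix.conjTranspose_kronecker Q Q']
  simp only [contract_eq, blockFst_one_kronecker_conj, Matrix.mul_kronecker_mul, Finset.mul_sum,
    Finset.sum_mul, Matrix.mul_smul, Matrix.smul_mul]

variable [DecidableEq A]

lemma contract_leftMap_apply (Φ : Module.End ℂ (Matrix A A ℂ)) (X : Matrix (A × B) (A × B) ℂ)
    (Y : Matrix (A × R) (A × R) ℂ) (p q : B × R) : contract X (leftMap R Φ Y) p q =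
      Fintype.card A * (Matrix.vecMulVec (fun t : A × A => blockSnd Y p.2 q.2 t.1 t.2)
        (fun s : A × A => blockSnd X p.1 q.1 s.1 s.2) * transfer Φ).trace := by
  have hentry (a a' : A) : leftMap R Φ Y (a, p.2) (a', q.2) =
      ∑ t, transfer Φ (a, a') t * blockSnd Y p.2 q.2 t.1 t.2 :=
    map_apply_eq_sum_transfer Φ (blockSnd Y p.2 q.2) a a'
  simp only [contract_apply, hentry, Matrix.trace, Matrix.diag, Matrix.mul_apply,
    Matrix.vecMulVec_apply]
  rw [← Fintype.sum_prod_type' fun a a' => X (a, p.1) (a', q.1) * _, Finset.sum_comm]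
  simp only [Finset.mul_sum]
  have hcomm (x t y : ℂ) : x * (t * y) = y * x * t := by ring
  exact Finset.sum_congr rfl fun s _ => Finset.sum_congr rfl fun t _ => congrArg _ (hcomm _ _ _)

lemma contract_leftMap_depolarize (X : Matrix (A × B) (A × B) ℂ)
    (Y : Matrix (A × R) (A × R) ℂ) :
    contract X (leftMap R (depolarize A) Y) = traceLeft X ⊗ₖ traceLeft Y := by
  ext p q
  simp only [leftMap_depolarize, contract_apply, Matrix.smul_apply, Matrix.kroneckerMap_apply,
    Matrix.one_apply, ite_mul, one_mul, zero_mul, smul_eq_mul, mul_ite, mul_zero, Finset.sum_ite_eq,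
    Finset.mem_univ, if_true, traceLeft, Matrix.of_apply]
  rw [Finset.sum_mul, Finset.mul_sum]
  refine Finset.sum_congr rfl fun a _ => ?_
  have : Nonempty A := ⟨a⟩
  have hd : (Fintype.card A : ℂ) ≠ 0 := Nat.cast_ne_zero.mpr Fintype.card_ne_zero
  field_simp

end Contract

section Bounds

variable {A B R Ω : Type*} [Fintype A]

lemma lintegral_ofReal_le [TopologicalSpace Ω] [CompactSpace Ω] [MeasurableSpace Ω]
    [OpensMeasurableSpace Ω] {μ : Measure Ω} [IsFiniteMeasure μ] {f g : Ω → ℝ} (hg : Continuous g)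
    (hfg : ∀ ω, f ω ≤ g ω) (hg₀ : ∀ ω, 0 ≤ g ω) :
    ∫⁻ ω, ENNReal.ofReal (f ω) ∂μ ≤ ENNReal.ofReal (∫ ω, g ω ∂μ) := by
  rw [ofReal_integral_eq_lintegral_ofReal (integrable_of_continuous μ hg) (.of_forall hg₀)]
  exact lintegral_mono fun ω => ENNReal.ofReal_le_ofReal (hfg ω)

lemma lintegral_schattenNorm_one_add_le [TopologicalSpace Ω] [MeasurableSpace Ω]
    [OpensMeasurableSpace Ω] {μ : Measure Ω} [DecidableEq A] {F G : Ω → Matrix A A ℂ}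
    (hF : ∀ ω, (F ω).IsHermitian) (hG : ∀ ω, (G ω).IsHermitian) (hG' : Continuous G) :
    ∫⁻ ω, ENNReal.ofReal (schattenNorm 1 (F ω + G ω)) ∂μ ≤
      ∫⁻ ω, ENNReal.ofReal (schattenNorm 1 (F ω)) ∂μ +
        ∫⁻ ω, ENNReal.ofReal (schattenNorm 1 (G ω)) ∂μ := by
  rw [← lintegral_add_right _ (continuous_schattenNorm_one hG' hG).measurable.ennreal_ofReal]
  exact lintegral_mono fun ω => (ENNReal.ofReal_le_ofReal
    (schattenNorm_one_add_le (hF ω) (hG ω))).trans ENNReal.ofReal_add_le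

lemma sq_integral_le_integral_sq [TopologicalSpace Ω] [CompactSpace Ω] [MeasurableSpace Ω]
    [OpensMeasurableSpace Ω] {μ : Measure Ω} [IsProbabilityMeasure μ] {f : Ω → ℝ}
    (hf : Continuous f) : (∫ ω, f ω ∂μ) ^ 2 ≤ ∫ ω, f ω ^ 2 ∂μ :=
  even_two.convexOn_pow.map_integral_le (continuous_pow 2).continuousOn isClosed_univ
    (.of_forall fun _ => Set.mem_univ _) (integrable_of_continuous μ hf)
    (integrable_of_continuous μ (hf.pow 2))

lemma continuous_contract_leftMap [TopologicalSpace Ω] [DecidableEq A]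
    {Φ : Ω → Module.End ℂ (Matrix A A ℂ)} (hΦ : Continuous fun ω => transfer (Φ ω))
    (X : Matrix (A × B) (A × B) ℂ) (Y : Matrix (A × R) (A × R) ℂ) :
    Continuous fun ω => contract X (leftMap R (Φ ω) Y) := by
  refine continuous_matrix fun p q => ?_
  simp only [contract_leftMap_apply]
  exact continuous_const.mul (continuous_const.matrix_mul hΦ).matrix_trace

section TraceNorm

variable [Fintype B] [DecidableEq B] [Fintype R] [DecidableEq R]

lemma schattenNorm_one_contract_sub_le {X₁ X₂ : Matrix (A × B) (A × B) ℂ}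
    {Y₁ Y₂ : Matrix (A × R) (A × R) ℂ} (hX₁ : X₁.PosSemidef) (hX₂ : X₂.PosSemidef)
    (hY₁ : Y₁.PosSemidef) (hY₂ : Y₂.PosSemidef) :
    schattenNorm 1 (contract (X₁ - X₂) (Y₁ - Y₂)) ≤ (contract (X₁ + X₂) (Y₁ + Y₂)).trace.re := by
  have h := schattenNorm_one_sub_le_trace_add
    ((posSemidef_contract hX₁ hY₁).add (posSemidef_contract hX₂ hY₂))
    ((posSemidef_contract hX₁ hY₂).add (posSemidef_contract hX₂ hY₁))
  convert h using 2
  · simp only [map_sub, LinearMap.sub_apply]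
    abel
  · simp only [map_add, LinearMap.add_apply]
    congr 1
    abel

lemma schattenNorm_one_contract_leftMap_sub_le {S T : Module.End ℂ (Matrix A A ℂ)}
    (hS : IsCompletelyPositive S) (hT : IsCompletelyPositive T)
    {X₁ X₂ : Matrix (A × B) (A × B) ℂ} {Y₁ Y₂ : Matrix (A × R) (A × R) ℂ}
    (hX₁ : X₁.PosSemidef) (hX₂ : X₂.PosSemidef) (hY₁ : Y₁.PosSemidef) (hY₂ : Y₂.PosSemidef) :
    schattenNorm 1 (contract (X₁ - X₂) (leftMap R (S - T) (Y₁ - Y₂))) ≤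
      (contract (X₁ + X₂) (leftMap R (S + T) (Y₁ + Y₂))).trace.re := by
  have h := schattenNorm_one_contract_sub_le hX₁ hX₂
    ((hS.posSemidef_leftMap hY₁).add (hT.posSemidef_leftMap hY₂))
    ((hS.posSemidef_leftMap hY₂).add (hT.posSemidef_leftMap hY₁))
  have hsub : leftMap R (S - T) (Y₁ - Y₂) = leftMap R S Y₁ + leftMap R T Y₂ -
      (leftMap R S Y₂ + leftMap R T Y₁) := by
    simp only [leftMap_sub, map_sub, LinearMap.sub_apply]
    abel
  have hadd : leftMap R (S + T) (Y₁ + Y₂) = leftMap R S Y₁ + leftMap R T Y₂ +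
      (leftMap R S Y₂ + leftMap R T Y₁) := by
    simp only [leftMap_add, map_add, LinearMap.add_apply]
    abel
  rwa [hsub, hadd]

end TraceNorm

namespace IsDecouplingFamily

variable [TopologicalSpace Ω] [MeasurableSpace Ω] {μ : Measure Ω} [DecidableEq A]
  {L L' : Ω → Module.End ℂ (Matrix A A ℂ)} {c κ : ℝ}

lemma continuous_contract (h : IsDecouplingFamily μ L L' c κ) (X : Matrix (A × B) (A × B) ℂ)
    (Y : Matrix (A × R) (A × R) ℂ) :
    Continuous fun ω => contract X (leftMap R (L ω - L' ω) Y) :=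
  continuous_contract_leftMap (h.continuous_left.sub h.continuous_right) X Y

lemma isHermitian_contract [Finite R] (h : IsDecouplingFamily μ L L' c κ)
    {X : Matrix (A × B) (A × B) ℂ} {Y : Matrix (A × R) (A × R) ℂ} (hX : X.IsHermitian)
    (hY : Y.IsHermitian) (ω : Ω) : (contract X (leftMap R (L ω - L' ω) Y)).IsHermitian :=
  Decoupling.isHermitian_contract hX
    (((h.isCompletelyPositive_left ω).isHermitian_leftMap hY).sub
      ((h.isCompletelyPositive_right ω).isHermitian_leftMap hY))

variable [CompactSpace Ω] [OpensMeasurableSpace Ω] [IsFiniteMeasure μ]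

lemma integral_trace_mul_transfer_add (h : IsDecouplingFamily μ L L' c κ)
    (K : Matrix (A × A) (A × A) ℂ) :
    ∫ ω, (K * transfer (L ω + L' ω)).trace ∂μ = c * (K * transfer (depolarize A)).trace := by
  have hint (s t : A × A) : Integrable (fun ω => K t s * transfer (L ω + L' ω) s t) μ :=
    (integrable_of_continuous μ
      ((h.continuous_left.add h.continuous_right).matrix_elem s t)).const_mul _
  simp only [Matrix.trace, Matrix.diag, Matrix.mul_apply]
  rw [integral_finsetSum _ fun t _ => integrable_finsetSum _ fun s _ => hint s t]
  simp only [integral_finsetSum _ fun s _ => hint s _, integral_const_mul,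
    h.integral_transfer_add, mul_left_comm _ (c : ℂ), ← Finset.mul_sum]

lemma integral_contract_add (h : IsDecouplingFamily μ L L' c κ) (X : Matrix (A × B) (A × B) ℂ)
    (Y : Matrix (A × R) (A × R) ℂ) (p q : B × R) :
    ∫ ω, contract X (leftMap R (L ω + L' ω) Y) p q ∂μ =
      c * (traceLeft X ⊗ₖ traceLeft Y) p q := by
  simp only [← contract_leftMap_depolarize, contract_leftMap_apply]
  rw [integral_const_mul, h.integral_trace_mul_transfer_add, mul_left_comm]

lemma integral_frobSq_contract_le [Fintype B] [Fintype R] (h : IsDecouplingFamily μ L L' c κ)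
    (X : Matrix (A × B) (A × B) ℂ) (Y : Matrix (A × R) (A × R) ℂ) :
    ∫ ω, frobSq (contract X (leftMap R (L ω - L' ω) Y)) ∂μ ≤ κ ^ 2 * (frobSq X * frobSq Y) := by
  have hκ : (Fintype.card A : ℝ) ^ 2 * (κ / Fintype.card A) ^ 2 ≤ κ ^ 2 := by
    rw [← mul_pow, mul_comm]
    refine pow_le_pow_left₀ (mul_nonneg (div_nonneg h.factor_nonneg (Nat.cast_nonneg _))
      (Nat.cast_nonneg _)) ?_ 2
    rw [div_mul_comm]
    exact mul_le_of_le_one_left h.factor_nonneg (div_self_le_one _)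
  have hentry (p q : B × R) :
      ∫ ω, ‖contract X (leftMap R (L ω - L' ω) Y) p q‖ ^ 2 ∂μ ≤
        κ ^ 2 * (frobSq (blockSnd X p.1 q.1) * frobSq (blockSnd Y p.2 q.2)) := by
    simp only [contract_leftMap_apply, norm_mul, mul_pow, Complex.norm_natCast]
    rw [integral_const_mul]
    refine (mul_le_mul_of_nonneg_left (h.integral_sq_norm_trace_mul_transfer_sub_le _)
      (sq_nonneg _)).trans ?_
    rw [← mul_assoc, frobSq_vecMulVec, Fintype.sum_prod_type, Fintype.sum_prod_type, mul_comm
      (frobSq _) (frobSq _)]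
    exact mul_le_mul_of_nonneg_right hκ (mul_nonneg (frobSq_nonneg _) (frobSq_nonneg _))
  rw [integral_frobSq (h.continuous_contract X Y), ← sum_frobSq_blockSnd X,
    ← sum_frobSq_blockSnd Y]
  refine (Finset.sum_le_sum fun p _ => Finset.sum_le_sum fun q _ => hentry p q).trans_eq ?_
  simp only [← Finset.mul_sum, Fintype.sum_prod_type, Finset.sum_mul_sum]

lemma integral_trace_contract_add [Fintype B] [Fintype R] (h : IsDecouplingFamily μ L L' c κ)
    (X : Matrix (A × B) (A × B) ℂ) (Y : Matrix (A × R) (A × R) ℂ) :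
    ∫ ω, (contract X (leftMap R (L ω + L' ω) Y)).trace ∂μ = c * (X.trace * Y.trace) := by
  have hint (p : B × R) : Integrable (fun ω => contract X (leftMap R (L ω + L' ω) Y) p p) μ :=
    integrable_of_continuous μ ((continuous_contract_leftMap
      (h.continuous_left.add h.continuous_right) X Y).matrix_elem p p)
  simp only [Matrix.trace, Matrix.diag]
  rw [integral_finsetSum _ fun p _ => hint p]
  simp only [h.integral_contract_add, ← Finset.mul_sum]
  congr 1
  refine (Matrix.trace_kronecker _ _).trans ?_
  rw [trace_traceLeft, trace_traceLeft]
  rfl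

lemma lintegral_schattenNorm_one_le [Fintype B] [DecidableEq B] [Fintype R] [DecidableEq R]
    (h : IsDecouplingFamily μ L L' c κ) {X : Matrix (A × B) (A × B) ℂ}
    {Y : Matrix (A × R) (A × R) ℂ} (hX : X.IsHermitian) (hY : Y.IsHermitian) :
    ∫⁻ ω, ENNReal.ofReal (schattenNorm 1 (contract X (leftMap R (L ω - L' ω) Y))) ∂μ ≤
      ENNReal.ofReal (c * (schattenNorm 1 X * schattenNorm 1 Y)) := by
  obtain ⟨X₁, X₂, hX₁, hX₂, rfl, hXnorm⟩ := exists_sub_posSemidef hX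
  obtain ⟨Y₁, Y₂, hY₁, hY₂, rfl, hYnorm⟩ := exists_sub_posSemidef hY
  have hcont : Continuous fun ω =>
      (contract (X₁ + X₂) (leftMap R (L ω + L' ω) (Y₁ + Y₂))).trace :=
    (continuous_contract_leftMap (h.continuous_left.add h.continuous_right) _ _).matrix_trace
  have hle (ω : Ω) : schattenNorm 1 (contract (X₁ - X₂) (leftMap R (L ω - L' ω) (Y₁ - Y₂))) ≤
      (contract (X₁ + X₂) (leftMap R (L ω + L' ω) (Y₁ + Y₂))).trace.re :=
    schattenNorm_one_contract_leftMap_sub_le (h.isCompletelyPositive_left ω)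
      (h.isCompletelyPositive_right ω) hX₁ hX₂ hY₁ hY₂
  have hmean : ∫ ω, (contract (X₁ + X₂) (leftMap R (L ω + L' ω) (Y₁ + Y₂))).trace.re ∂μ =
      c * (schattenNorm 1 (X₁ - X₂) * schattenNorm 1 (Y₁ - Y₂)) := by
    refine (integral_re (integrable_of_continuous μ hcont)).trans ?_
    rw [h.integral_trace_contract_add, hXnorm, hYnorm, RCLike.re_to_complex, Complex.re_ofReal_mul,
      Complex.mul_re, ← (Complex.nonneg_iff.mp (hX₁.add hX₂).trace_nonneg).2, zero_mul, sub_zero]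
  rw [← hmean]
  exact lintegral_ofReal_le (Complex.continuous_re.comp hcont) hle fun ω =>
    (schattenNorm_one_nonneg (h.isHermitian_contract hX hY ω)).trans (hle ω)

end IsDecouplingFamily

lemma IsDecouplingFamily.lintegral_schattenNorm_one_conj_le [TopologicalSpace Ω]
    [CompactSpace Ω] [MeasurableSpace Ω] [OpensMeasurableSpace Ω] {μ : Measure Ω}
    [IsProbabilityMeasure μ] [DecidableEq A] [Fintype B] [DecidableEq B] [Fintype R]
    [DecidableEq R] {L L' : Ω → Module.End ℂ (Matrix A A ℂ)} {c κ : ℝ}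
    (h : IsDecouplingFamily μ L L' c κ) {X : Matrix (A × B) (A × B) ℂ}
    {Y : Matrix (A × R) (A × R) ℂ} (hX : X.IsHermitian) (hY : Y.IsHermitian)
    {Q : Matrix B B ℂ} {Q' : Matrix R R ℂ} (hQ : Q.IsHermitian) (hQ' : Q'.IsHermitian)
    (hQ₁ : frobSq (Q * Q) ≤ 1) (hQ₁' : frobSq (Q' * Q') ≤ 1) :
    ∫⁻ ω, ENNReal.ofReal (schattenNorm 1
        (contract (((1 : Matrix A A ℂ) ⊗ₖ Q) * X * ((1 : Matrix A A ℂ) ⊗ₖ Q)ᴴ)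
          (leftMap R (L ω - L' ω)
            (((1 : Matrix A A ℂ) ⊗ₖ Q') * Y * ((1 : Matrix A A ℂ) ⊗ₖ Q')ᴴ)))) ∂μ ≤
      ENNReal.ofReal (κ * (schattenNorm 2 X * schattenNorm 2 Y)) := by
  have hQQ : (Q ⊗ₖ Q').IsHermitian := by
    rw [Matrix.IsHermitian, Matrix.conjTranspose_kronecker, hQ.eq, hQ'.eq]
  have hweight : √(frobSq ((Q ⊗ₖ Q') * (Q ⊗ₖ Q'))) ≤ 1 := by
    rw [← Matrix.mul_kronecker_mul, frobSq_kronecker]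
    exact Real.sqrt_le_one.mpr (mul_le_one₀ hQ₁ (frobSq_nonneg _) hQ₁')
  let f (ω : Ω) : ℝ := √(frobSq (contract X (leftMap R (L ω - L' ω) Y)))
  have hf : Continuous f := (continuous_frobSq.comp (h.continuous_contract X Y)).sqrt
  have hle (ω : Ω) : schattenNorm 1
      (contract (((1 : Matrix A A ℂ) ⊗ₖ Q) * X * ((1 : Matrix A A ℂ) ⊗ₖ Q)ᴴ)
        (leftMap R (L ω - L' ω)
          (((1 : Matrix A A ℂ) ⊗ₖ Q') * Y * ((1 : Matrix A A ℂ) ⊗ₖ Q')ᴴ))) ≤ f ω := by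
    rw [leftMap_one_kronecker_conj, contract_conj, hQQ.eq]
    exact (schattenNorm_one_conj_le hQQ (h.isHermitian_contract hX hY ω)).trans
      (mul_le_of_le_one_left (Real.sqrt_nonneg _) hweight)
  have hmean : ∫ ω, f ω ∂μ ≤ κ * (schattenNorm 2 X * schattenNorm 2 Y) := by
    rw [schattenNorm_two, schattenNorm_two]
    refine abs_le_of_sq_le_sq' ((sq_integral_le_integral_sq hf).trans ?_)
      (mul_nonneg h.factor_nonneg (by positivity)) |>.2
    simp only [f, mul_pow, Real.sq_sqrt (frobSq_nonneg _)]
    exact h.integral_frobSq_contract_le X Y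
  exact (lintegral_ofReal_le hf hle fun ω => Real.sqrt_nonneg _).trans
    (ENNReal.ofReal_le_ofReal hmean)

end Bounds

section Exponential

lemma log_two_coe_pos : (0 : EReal) < (Real.log 2 : ℝ) := by
  exact_mod_cast Real.log_pos one_lt_two

lemma pow2_mono {x y : EReal} (h : x ≤ y) : pow2 x ≤ pow2 y :=
  EReal.exp_monotone (mul_le_mul_of_nonneg_right h log_two_coe_pos.le)

lemma pow2_add (x y : EReal) : pow2 (x + y) = pow2 x * pow2 y := by
  rw [pow2, EReal.right_distrib_of_nonneg_of_ne_top log_two_coe_pos.le (EReal.coe_ne_top _),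
    EReal.exp_add]
  rfl

lemma pow2_log2 (c : ℝ≥0∞) : pow2 (log2 c) = c := by
  rw [pow2, log2, EReal.div_mul_cancel (EReal.coe_ne_bot _) (EReal.coe_ne_top _)
    log_two_coe_pos.ne', ENNReal.exp_log]

lemma log2_mono {c d : ℝ≥0∞} (h : c ≤ d) : log2 c ≤ log2 d :=
  EReal.div_le_div_right_of_nonneg log_two_coe_pos.le (ENNReal.log_monotone h)

lemma half_mul_two_mul (x : EReal) : ((1 / 2 : ℝ) : EReal) * (2 * x) = x := by
  rw [← mul_assoc, show (2 : EReal) = ((2 : ℝ) : EReal) from rfl, ← EReal.coe_mul]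
  norm_num

lemma le_pow2_half_mul {c : ℝ≥0∞} {x : EReal} (h : 2 * log2 c ≤ x) :
    c ≤ pow2 (((1 / 2 : ℝ) : EReal) * x) := by
  conv_lhs => rw [← pow2_log2 c, ← half_mul_two_mul (log2 c)]
  exact pow2_mono (mul_le_mul_of_nonneg_left h (by norm_num))

end Exponential

section FourthRoot

variable {n m : Type*} [Fintype n] [DecidableEq n] [Fintype m] [DecidableEq m]

/-- The fourth root `β^(1/4)` of a positive semidefinite matrix `β`. -/
def fourthRoot (β : Matrix n n ℂ) : Matrix n n ℂ := cfc (fun x : ℝ => x ^ (1 / 4 : ℝ)) β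

lemma isHermitian_fourthRoot (β : Matrix n n ℂ) : (fourthRoot β).IsHermitian :=
  cfc_predicate _ _

lemma isHermitian_invFourthRoot (β : Matrix n n ℂ) : (invFourthRoot β).IsHermitian :=
  cfc_predicate _ _

lemma fourthRoot_pow_four {β : Matrix n n ℂ} (hβ : β.PosSemidef) :
    fourthRoot β * fourthRoot β * (fourthRoot β * fourthRoot β) = β := by
  rw [fourthRoot, cfc_mul_cfc, cfc_mul_cfc]
  conv_rhs => rw [← cfc_self hβ.isHermitian]
  refine cfc_congr fun x hx => ?_
  have hx := nonneg_of_mem_spectrum hβ hx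
  rw [← Real.rpow_add_of_nonneg hx (by norm_num) (by norm_num),
    ← Real.rpow_add_of_nonneg hx (by norm_num) (by norm_num)]
  norm_num

lemma frobSq_fourthRoot_mul_self {β : Matrix n n ℂ} (hβ : β.PosSemidef) :
    frobSq (fourthRoot β * fourthRoot β) = β.trace.re := by
  have h : (fourthRoot β * fourthRoot β).IsHermitian := by
    rw [Matrix.IsHermitian, Matrix.conjTranspose_mul, (isHermitian_fourthRoot β).eq]
  rw [frobSq_of_isHermitian h, fourthRoot_pow_four hβ]

lemma fourthRoot_mul_invFourthRoot_mul {β : Matrix n n ℂ} (hβ : β.PosSemidef) :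
    fourthRoot β * invFourthRoot β * β = β := by
  nth_rewrite 3 [← cfc_self hβ.isHermitian]
  rw [fourthRoot, invFourthRoot, cfc_mul_cfc, cfc_mul_cfc]
  conv_rhs => rw [← cfc_self hβ.isHermitian]
  refine cfc_congr fun x hx => ?_
  rcases (nonneg_of_mem_spectrum hβ hx).eq_or_lt with rfl | hx
  · simp
  · rw [if_neg hx.ne', ← Real.rpow_add hx]
    norm_num

lemma one_kronecker_fourthRoot {β : Matrix n n ℂ} (hβ : β.IsHermitian) :
    (1 : Matrix m m ℂ) ⊗ₖ fourthRoot β = fourthRoot ((1 : Matrix m m ℂ) ⊗ₖ β) := by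
  let oneKronecker : Matrix n n ℂ →⋆ₐ[ℝ] Matrix (m × n) (m × n) ℂ :=
    { toFun := fun M => (1 : Matrix m m ℂ) ⊗ₖ M
      map_one' := Matrix.one_kronecker_one
      map_mul' := fun M N => by rw [← Matrix.mul_kronecker_mul, one_mul]
      map_zero' := Matrix.kronecker_zero _
      map_add' := Matrix.kronecker_add _
      commutes' := fun r => by
        rw [Algebra.algebraMap_eq_smul_one, Algebra.algebraMap_eq_smul_one, Matrix.kronecker_smul,
          Matrix.one_kronecker_one]
      map_star' := fun M => by
        rw [Matrix.star_eq_conjTranspose, Matrix.star_eq_conjTranspose,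
          Matrix.conjTranspose_kronecker, Matrix.conjTranspose_one] }
  have hcont : Continuous oneKronecker := continuous_matrix fun i j =>
    continuous_const.mul (continuous_id.matrix_elem i.2 j.2)
  have hβ' : IsSelfAdjoint β := hβ
  exact StarAlgHom.map_cfc oneKronecker _ β (continuousOn_spectrum _ _) hcont hβ'
    (hβ'.map oneKronecker)

end FourthRoot

section Support

open scoped MatrixOrder

variable {n m : Type*} [Fintype n] [Fintype m]

lemma mul_eq_self_of_support_le {M N Q : Matrix n n ℂ} (h : support M ≤ support N)
    (hQ : Q * N = N) : Q * M = M := by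
  classical
  refine Matrix.ext_of_mulVec_single fun j => ?_
  obtain ⟨w, hw⟩ := h ⟨Pi.single j 1, rfl⟩
  simp only [Matrix.mulVecLin_apply] at hw
  rw [← Matrix.mulVec_mulVec, ← hw, Matrix.mulVec_mulVec, hQ]

lemma fourthRoot_conj_of_support_le [DecidableEq n] {M β : Matrix n n ℂ} (hβ : β.PosSemidef)
    (hM : M.IsHermitian) (h : support M ≤ support β) :
    fourthRoot β * (invFourthRoot β * M * invFourthRoot β) * fourthRoot β = M := by
  have hleft := mul_eq_self_of_support_le h (fourthRoot_mul_invFourthRoot_mul hβ)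
  have hright : M * (invFourthRoot β * fourthRoot β) = M := by
    simpa only [Matrix.conjTranspose_mul, hM.eq, (isHermitian_fourthRoot β).eq,
      (isHermitian_invFourthRoot β).eq] using congrArg Matrix.conjTranspose hleft
  calc fourthRoot β * (invFourthRoot β * M * invFourthRoot β) * fourthRoot β
      = fourthRoot β * invFourthRoot β * (M * (invFourthRoot β * fourthRoot β)) := by
        simp only [mul_assoc]
    _ = M := by rw [hright, hleft]

lemma support_le_of_ker_le {M N : Matrix n n ℂ} (hM : M.IsHermitian) (hN : N.IsHermitian)
    (h : ∀ v, N *ᵥ v = 0 → M *ᵥ v = 0) : support M ≤ support N := by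
  classical
  let Q : Matrix n n ℂ := cfc (fun x : ℝ => x⁻¹) N
  have hNQN : N * Q * N = N := by
    rw [show N * Q * N = cfc (fun x : ℝ => x) N * Q * cfc (fun x : ℝ => x) N by rw [cfc_self hN],
      cfc_mul_cfc, cfc_mul_cfc]
    simp only [mul_inv_mul_cancel, cfc_self hN]
  have hMQN : M * (Q * N) = M := by
    refine Matrix.ext_of_mulVec_single fun j => ?_
    rw [← sub_eq_zero, ← Matrix.mulVec_mulVec, ← Matrix.mulVec_sub]
    refine h _ ?_
    rw [Matrix.mulVec_sub, Matrix.mulVec_mulVec, ← mul_assoc, hNQN, sub_self]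
  have hQ : Q.IsHermitian := cfc_predicate _ N
  have hNQM : N * Q * M = M := by
    simpa only [Matrix.conjTranspose_mul, hM.eq, hN.eq, hQ.eq]
      using congrArg Matrix.conjTranspose hMQN
  rintro _ ⟨v, rfl⟩
  refine ⟨(Q * M) *ᵥ v, ?_⟩
  simp only [Matrix.mulVecLin_apply, Matrix.mulVec_mulVec, ← mul_assoc, hNQM]

lemma support_le_one_kronecker_traceLeft [DecidableEq m] {M : Matrix (m × n) (m × n) ℂ}
    (hM : M.PosSemidef) : support M ≤ support ((1 : Matrix m m ℂ) ⊗ₖ traceLeft M) := by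
  classical
  refine support_le_of_ker_le hM.isHermitian (Matrix.PosSemidef.one.kronecker
    (posSemidef_traceLeft hM)).isHermitian fun v hv => ?_
  obtain ⟨B, hB⟩ := CStarAlgebra.nonneg_iff_eq_star_mul_self.mp hM.nonneg
  obtain rfl : M = Bᴴ * B := hB
  let C : Matrix ((m × n) × m) n ℂ := Matrix.of fun p i => B p.1 (p.2, i)
  have htrace : traceLeft (Bᴴ * B) = Cᴴ * C := by
    ext i j
    simp only [traceLeft, C, Matrix.of_apply, Matrix.mul_apply, Matrix.conjTranspose_apply,
      Fintype.sum_prod_type_right]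
  have hC (x : m) : C *ᵥ (fun i => v (x, i)) = 0 := by
    rw [← Matrix.conjTranspose_mul_self_mulVec_eq_zero, ← htrace]
    ext i
    simpa [Matrix.mulVec, dotProduct, Fintype.sum_prod_type, Matrix.one_apply] using
      congrFun hv (x, i)
  rw [Matrix.conjTranspose_mul_self_mulVec_eq_zero]
  ext k
  simp only [Matrix.mulVec, dotProduct, Fintype.sum_prod_type, Pi.zero_apply]
  exact Finset.sum_eq_zero fun x _ => congrFun (hC x) (k, x)

end Support

section Smoothing

variable {X Y : Type*} [Fintype X] [DecidableEq X] [Fintype Y] [DecidableEq Y]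

/-- The subnormalised density matrices in the smoothing ball of `ω` that are supported on
`1 ⊗ ω^Y`, and so have a finite divergence relative to it. -/
def smoothingSet (ε : ℝ) (ω : Matrix (X × Y) (X × Y) ℂ) : Set (Matrix (X × Y) (X × Y) ℂ) :=
  {α | IsSubnormalised α ∧ schattenNorm 1 (α - ω) ≤ ε * ω.trace.re ∧
    support α ≤ support ((1 : Matrix X X ℂ) ⊗ₖ traceLeft ω)}

/-- The operator `(1 ⊗ β)^(-1/4) α (1 ⊗ β)^(-1/4)`, whose Hilbert–Schmidt norm is the exponential
of half the Rényi-2 divergence of `α` relative to `1 ⊗ β`. -/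
def whiten (β : Matrix Y Y ℂ) (α : Matrix (X × Y) (X × Y) ℂ) : Matrix (X × Y) (X × Y) ℂ :=
  invFourthRoot ((1 : Matrix X X ℂ) ⊗ₖ β) * α * invFourthRoot ((1 : Matrix X X ℂ) ⊗ₖ β)

lemma isHermitian_whiten (β : Matrix Y Y ℂ) {α : Matrix (X × Y) (X × Y) ℂ} (hα : α.IsHermitian) :
    (whiten β α).IsHermitian := by
  simpa only [whiten, (isHermitian_invFourthRoot ((1 : Matrix X X ℂ) ⊗ₖ β)).eq] using
    Matrix.isHermitian_mul_mul_conjTranspose (invFourthRoot ((1 : Matrix X X ℂ) ⊗ₖ β)) hα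

lemma fourthRoot_conj_whiten {β : Matrix Y Y ℂ} (hβ : β.PosSemidef)
    {α : Matrix (X × Y) (X × Y) ℂ} (hα : α.IsHermitian)
    (h : support α ≤ support ((1 : Matrix X X ℂ) ⊗ₖ β)) :
    ((1 : Matrix X X ℂ) ⊗ₖ fourthRoot β) * whiten β α *
      ((1 : Matrix X X ℂ) ⊗ₖ fourthRoot β)ᴴ = α := by
  rw [one_kronecker_fourthRoot hβ.isHermitian, (isHermitian_fourthRoot _).eq]
  exact fourthRoot_conj_of_support_le (Matrix.PosSemidef.one.kronecker hβ) hα h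

lemma self_mem_smoothingSet {ε : ℝ} (hε : 0 ≤ ε) {ω : Matrix (X × Y) (X × Y) ℂ}
    (hω : IsSubnormalised ω) : ω ∈ smoothingSet ε ω := by
  refine ⟨hω, ?_, support_le_one_kronecker_traceLeft hω.1⟩
  rw [sub_self, schattenNorm_one_of_posSemidef .zero, Matrix.trace_zero, Complex.zero_re]
  exact mul_nonneg hε (re_trace_nonneg hω.1)

lemma iInf_schattenNorm_two_whiten_le (ε : ℝ) (ω : Matrix (X × Y) (X × Y) ℂ) :
    ⨅ α : smoothingSet ε ω, ENNReal.ofReal (schattenNorm 2 (whiten (traceLeft ω) α.1)) ≤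
      pow2 (-((1 / 2 : ℝ) : EReal) * smoothCondEntropy ε ω) := by
  rw [smoothCondEntropy, neg_mul_neg]
  refine le_pow2_half_mul (le_iInf fun α => ?_)
  rw [renyiTwoDiv]
  split_ifs with h
  · exact mul_le_mul_of_nonneg_left (log2_mono (iInf_le
      (fun α : smoothingSet ε ω => ENNReal.ofReal (schattenNorm 2 (whiten (traceLeft ω) α.1)))
      ⟨α.1, α.2.1, α.2.2, h⟩)) zero_le_two
  · exact le_top

lemma le_add_mul_pow2_of_forall_smoothingSet {X' Y' : Type*} [Fintype X'] [DecidableEq X']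
    [Fintype Y'] [DecidableEq Y'] {ε : ℝ} (hε : 0 ≤ ε) {ω : Matrix (X × Y) (X × Y) ℂ}
    {ω' : Matrix (X' × Y') (X' × Y') ℂ} (hω : IsSubnormalised ω) (hω' : IsSubnormalised ω')
    {a b k : ℝ≥0∞} (hk : k ≠ ∞)
    (h : ∀ α ∈ smoothingSet ε ω, ∀ α' ∈ smoothingSet ε ω', a ≤ b +
      k * (ENNReal.ofReal (schattenNorm 2 (whiten (traceLeft ω) α)) *
        ENNReal.ofReal (schattenNorm 2 (whiten (traceLeft ω') α')))) :
    a ≤ b + k * pow2 (-((1 / 2 : ℝ) : EReal) * smoothCondEntropy ε ω -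
      ((1 / 2 : ℝ) : EReal) * smoothCondEntropy ε ω') := by
  have : Nonempty (smoothingSet ε ω) := ⟨ω, self_mem_smoothingSet hε hω⟩
  have : Nonempty (smoothingSet ε ω') := ⟨ω', self_mem_smoothingSet hε hω'⟩
  rw [sub_eq_add_neg, ← EReal.neg_mul, pow2_add, ← tsub_le_iff_left]
  let f (α : smoothingSet ε ω) := ENNReal.ofReal (schattenNorm 2 (whiten (traceLeft ω) α.1))
  let g (α : smoothingSet ε ω') := ENNReal.ofReal (schattenNorm 2 (whiten (traceLeft ω') α.1))
  calc a - b ≤ (⨅ α, k * f α) * ⨅ α', g α' :=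
        ENNReal.le_iInf_mul_iInf
          ⟨Classical.arbitrary _, ENNReal.mul_ne_top hk ENNReal.ofReal_ne_top⟩
          ⟨Classical.arbitrary _, ENNReal.ofReal_ne_top⟩ fun α α' => by
            rw [tsub_le_iff_left, mul_assoc]
            exact h α.1 α.2 α'.1 α'.2
    _ = k * ((⨅ α, f α) * ⨅ α', g α') := by
        rw [← ENNReal.mul_iInf fun hk' => absurd hk' hk, mul_assoc]
    _ ≤ _ := by
        gcongr <;> exact iInf_schattenNorm_two_whiten_le ε _

end Smoothing

section SmoothedDecoupling

lemma IsSubnormalised.schattenNorm_one_le {n : Type*} [Fintype n] [DecidableEq n]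
    {α : Matrix n n ℂ} (hα : IsSubnormalised α) : schattenNorm 1 α ≤ 1 :=
  (schattenNorm_one_of_posSemidef hα.1).trans_le hα.2

lemma contract_eq_contract_add {A B R : Type*} [Fintype A] (X X' : Matrix (A × B) (A × B) ℂ)
    (Y Y' : Matrix (A × R) (A × R) ℂ) :
    contract X Y = contract X' Y' + contract (X - X') Y + contract X' (Y - Y') := by
  simp only [map_sub, LinearMap.sub_apply]
  abel

/-- The mean trace norm allowed to `contract X (leftMap R (L ω - L' ω) Y)` for a decoupling family
of constants `c` and `κ`: smoothing `X` and `Y` costs `c * ε` each, and `κ` is weighted by the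
smooth conditional entropies. -/
def decouplingBound {A B R : Type*} [Fintype A] [DecidableEq A] [Fintype B] [DecidableEq B]
    [Fintype R] [DecidableEq R] (c κ ε : ℝ) (X : Matrix (A × B) (A × B) ℂ)
    (Y : Matrix (A × R) (A × R) ℂ) : ℝ≥0∞ :=
  ENNReal.ofReal (2 * c * ε) + ENNReal.ofReal κ *
    pow2 (-((1 / 2 : ℝ) : EReal) * smoothCondEntropy ε Y -
      ((1 / 2 : ℝ) : EReal) * smoothCondEntropy ε X)

variable {Ω : Type*} [TopologicalSpace Ω] [CompactSpace Ω] [MeasurableSpace Ω]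
  [OpensMeasurableSpace Ω] {μ : Measure Ω}
  {A B R : Type*} [Fintype A] [DecidableEq A] [Fintype B] [DecidableEq B] [Fintype R]
  [DecidableEq R] {L L' : Ω → Module.End ℂ (Matrix A A ℂ)} {c κ : ℝ}

namespace IsDecouplingFamily

lemma lintegral_schattenNorm_one_le_add [IsFiniteMeasure μ] (h : IsDecouplingFamily μ L L' c κ)
    {X X' : Matrix (A × B) (A × B) ℂ} {Y Y' : Matrix (A × R) (A × R) ℂ} (hX : X.IsHermitian)
    (hX' : X'.IsHermitian) (hY : Y.IsHermitian) (hY' : Y'.IsHermitian) :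
    ∫⁻ ω, ENNReal.ofReal (schattenNorm 1 (contract X (leftMap R (L ω - L' ω) Y))) ∂μ ≤
      ∫⁻ ω, ENNReal.ofReal (schattenNorm 1 (contract X' (leftMap R (L ω - L' ω) Y'))) ∂μ +
        ENNReal.ofReal (c * (schattenNorm 1 (X - X') * schattenNorm 1 Y)) +
        ENNReal.ofReal (c * (schattenNorm 1 X' * schattenNorm 1 (Y - Y'))) := by
  have h₁ := h.isHermitian_contract hX' hY'
  have h₂ := h.isHermitian_contract (hX.sub hX') hY
  have h₃ := h.isHermitian_contract hX' (hY.sub hY')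
  have hsplit (ω : Ω) := contract_eq_contract_add X X' (leftMap R (L ω - L' ω) Y)
    (leftMap R (L ω - L' ω) Y')
  simp only [hsplit, ← map_sub (leftMap R _) Y Y']
  refine (lintegral_schattenNorm_one_add_le (fun ω => (h₁ ω).add (h₂ ω)) h₃
    (h.continuous_contract _ _)).trans ?_
  gcongr
  · refine (lintegral_schattenNorm_one_add_le h₁ h₂ (h.continuous_contract _ _)).trans ?_
    gcongr
    exact h.lintegral_schattenNorm_one_le (hX.sub hX') hY
  · exact h.lintegral_schattenNorm_one_le hX' (hY.sub hY')

variable [IsProbabilityMeasure μ]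

lemma lintegral_schattenNorm_one_le_whiten (h : IsDecouplingFamily μ L L' c κ) {ε : ℝ}
    {X α : Matrix (A × B) (A × B) ℂ} {Y β : Matrix (A × R) (A × R) ℂ} (hX : IsSubnormalised X)
    (hY : IsSubnormalised Y) (hα : α ∈ smoothingSet ε X) (hβ : β ∈ smoothingSet ε Y) :
    ∫⁻ ω, ENNReal.ofReal (schattenNorm 1 (contract α (leftMap R (L ω - L' ω) β))) ∂μ ≤
      ENNReal.ofReal (κ * (schattenNorm 2 (whiten (traceLeft X) α) *
        schattenNorm 2 (whiten (traceLeft Y) β))) := by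
  have hX' := posSemidef_traceLeft hX.1
  have hY' := posSemidef_traceLeft hY.1
  have hαh := hα.1.1.isHermitian
  have hβh := hβ.1.1.isHermitian
  have hbound := h.lintegral_schattenNorm_one_conj_le (isHermitian_whiten (traceLeft X) hαh)
    (isHermitian_whiten (traceLeft Y) hβh) (isHermitian_fourthRoot (traceLeft X))
    (isHermitian_fourthRoot (traceLeft Y))
    (by rw [frobSq_fourthRoot_mul_self hX', trace_traceLeft]; exact hX.2)
    (by rw [frobSq_fourthRoot_mul_self hY', trace_traceLeft]; exact hY.2)
  rwa [fourthRoot_conj_whiten hX' hαh hα.2.2, fourthRoot_conj_whiten hY' hβh hβ.2.2] at hbound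

theorem lintegral_schattenNorm_one_le_decouplingBound (h : IsDecouplingFamily μ L L' c κ)
    {X : Matrix (A × B) (A × B) ℂ} {Y : Matrix (A × R) (A × R) ℂ} (hX : IsSubnormalised X)
    (hY : IsSubnormalised Y) {ε : ℝ} (hε : 0 ≤ ε) :
    ∫⁻ ω, ENNReal.ofReal (schattenNorm 1 (contract X (leftMap R (L ω - L' ω) Y))) ∂μ ≤
      decouplingBound c κ ε X Y := by
  refine le_add_mul_pow2_of_forall_smoothingSet hε hY hX ENNReal.ofReal_ne_top fun β hβ α hα => ?_
  have hXα : schattenNorm 1 (X - α) * schattenNorm 1 Y ≤ ε := by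
    rw [schattenNorm_one_sub_rev]
    exact (mul_le_mul (hα.2.1.trans (mul_le_of_le_one_right hε hX.2)) hY.schattenNorm_one_le
      (schattenNorm_one_nonneg hY.1.isHermitian) hε).trans_eq (mul_one ε)
  have hYβ : schattenNorm 1 α * schattenNorm 1 (Y - β) ≤ ε := by
    rw [schattenNorm_one_sub_rev]
    exact (mul_le_mul hα.1.schattenNorm_one_le (hβ.2.1.trans (mul_le_of_le_one_right hε hY.2))
      (schattenNorm_one_nonneg (hβ.1.1.isHermitian.sub hY.1.isHermitian)) zero_le_one).trans_eq
      (one_mul ε)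
  have hc := h.scale_nonneg
  calc ∫⁻ ω, ENNReal.ofReal (schattenNorm 1 (contract X (leftMap R (L ω - L' ω) Y))) ∂μ
      ≤ ∫⁻ ω, ENNReal.ofReal (schattenNorm 1 (contract α (leftMap R (L ω - L' ω) β))) ∂μ +
        ENNReal.ofReal (c * (schattenNorm 1 (X - α) * schattenNorm 1 Y)) +
        ENNReal.ofReal (c * (schattenNorm 1 α * schattenNorm 1 (Y - β))) :=
        h.lintegral_schattenNorm_one_le_add hX.1.isHermitian hα.1.1.isHermitian hY.1.isHermitian
          hβ.1.1.isHermitian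
    _ ≤ ENNReal.ofReal (κ * (schattenNorm 2 (whiten (traceLeft X) α) *
        schattenNorm 2 (whiten (traceLeft Y) β))) +
        ENNReal.ofReal (c * ε) + ENNReal.ofReal (c * ε) := by
        gcongr
        exact h.lintegral_schattenNorm_one_le_whiten hX hY hα hβ
    _ = _ := by
        rw [add_assoc, ← ENNReal.ofReal_add (by positivity) (by positivity), add_comm,
          ENNReal.ofReal_mul h.factor_nonneg, mul_comm (schattenNorm 2 _),
          ENNReal.ofReal_mul (by rw [schattenNorm_two]; positivity), ← two_mul, mul_assoc]

lemma lintegral_schattenNorm_one_comp_le (h : IsDecouplingFamily μ L L' c κ) {Ω' : Type*}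
    [MeasurableSpace Ω'] {ν : Measure Ω'} {φ : Ω' → Ω} (hφ : MeasurePreserving φ ν μ)
    {X : Matrix (A × B) (A × B) ℂ} {Y : Matrix (A × R) (A × R) ℂ} (hX : IsSubnormalised X)
    (hY : IsSubnormalised Y) {ε : ℝ} (hε : 0 ≤ ε) :
    ∫⁻ ω, ENNReal.ofReal (schattenNorm 1
        (contract X (leftMap R (L (φ ω) - L' (φ ω)) Y))) ∂ν ≤ decouplingBound c κ ε X Y := by
  have hnorm := continuous_schattenNorm_one (h.continuous_contract X Y)
    (h.isHermitian_contract hX.1.isHermitian hY.1.isHermitian)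
  exact (hφ.lintegral_comp hnorm.measurable.ennreal_ofReal).trans_le
    (h.lintegral_schattenNorm_one_le_decouplingBound hX hY hε)

end IsDecouplingFamily

end SmoothedDecoupling

section Marginals

variable {X Y Z : Type*} [Fintype X] [Fintype Y] [Fintype Z]

lemma IsSubnormalised.submatrix_equiv {m n : Type*} [Fintype m] [Fintype n] {M : Matrix m m ℂ}
    (hM : IsSubnormalised M) (e : n ≃ m) : IsSubnormalised (M.submatrix e e) :=
  ⟨hM.1.submatrix e, (congrArg Complex.re (e.sum_comp M.diag)).trans_le hM.2⟩

lemma IsSubnormalised.traceLeft {M : Matrix (X × Y) (X × Y) ℂ} (hM : IsSubnormalised M) :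
    IsSubnormalised (traceLeft M) :=
  ⟨posSemidef_traceLeft hM.1, (trace_traceLeft M).symm ▸ hM.2⟩

lemma IsSubnormalised.marginalSnd {M : Matrix ((X × Y) × Z) ((X × Y) × Z) ℂ}
    (hM : IsSubnormalised M) : IsSubnormalised (marginalSnd M) :=
  (hM.submatrix_equiv (Equiv.prodAssoc X Y Z).symm).traceLeft

lemma IsSubnormalised.marginalFst {M : Matrix ((X × Y) × Z) ((X × Y) × Z) ℂ}
    (hM : IsSubnormalised M) : IsSubnormalised (marginalFst M) :=
  (hM.submatrix_equiv ((Equiv.prodComm Y X).prodCongr (Equiv.refl Z))).marginalSnd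

end Marginals

section Decomposition

variable {A₁ A₂ B R : Type*}

lemma blockSnd_leftMap_tensorMap_depolarize_left [Fintype A₁] [DecidableEq A₁]
    (Ψ : Module.End ℂ (Matrix A₂ A₂ ℂ)) (ρ : Matrix ((A₁ × A₂) × R) ((A₁ × A₂) × R) ℂ) (r s : R) :
    blockSnd (leftMap R (tensorMap (depolarize A₁) Ψ) ρ) r s =
      (Fintype.card A₁ : ℂ)⁻¹ •
        ((1 : Matrix A₁ A₁ ℂ) ⊗ₖ blockSnd (leftMap R Ψ (marginalSnd ρ)) r s) := by
  rw [blockSnd_leftMap, blockSnd_leftMap, tensorMap, LinearMap.comp_apply, leftMap_depolarize,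
    traceLeft_rightMap]
  rfl

lemma blockSnd_leftMap_tensorMap_depolarize_right [Fintype A₂] [DecidableEq A₂]
    (Φ : Module.End ℂ (Matrix A₁ A₁ ℂ)) (ρ : Matrix ((A₁ × A₂) × R) ((A₁ × A₂) × R) ℂ) (r s : R) :
    blockSnd (leftMap R (tensorMap Φ (depolarize A₂)) ρ) r s =
      (Fintype.card A₂ : ℂ)⁻¹ •
        (blockSnd (leftMap R Φ (marginalFst ρ)) r s ⊗ₖ (1 : Matrix A₂ A₂ ℂ)) := by
  have h : rightMap A₁ (depolarize A₂) (blockSnd ρ r s) =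
      (Fintype.card A₂ : ℂ)⁻¹ • (blockSnd (marginalFst ρ) r s ⊗ₖ (1 : Matrix A₂ A₂ ℂ)) := by
    refine ext_blockFst fun i j => ?_
    rw [blockFst_rightMap, depolarize_apply, ← smul_smul]
    rfl
  rw [blockSnd_leftMap, blockSnd_leftMap, tensorMap, LinearMap.comp_apply, h, map_smul,
    leftMap_kronecker]

variable [Fintype A₁] [Fintype A₂]

lemma contract_leftMap_tensorMap_depolarize_left [DecidableEq A₁]
    (Ψ : Module.End ℂ (Matrix A₂ A₂ ℂ)) (τ : Matrix ((A₁ × A₂) × B) ((A₁ × A₂) × B) ℂ)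
    (ρ : Matrix ((A₁ × A₂) × R) ((A₁ × A₂) × R) ℂ) :
    contract τ (leftMap R (tensorMap (depolarize A₁) Ψ) ρ) =
      contract (marginalSnd τ) (leftMap R Ψ (marginalSnd ρ)) := by
  ext p q
  have hentry (a a' : A₁ × A₂) :
      leftMap R (tensorMap (depolarize A₁) Ψ) ρ (a, p.2) (a', q.2) = (Fintype.card A₁ : ℂ)⁻¹ *
        ((1 : Matrix A₁ A₁ ℂ) a.1 a'.1 * leftMap R Ψ (marginalSnd ρ) (a.2, p.2) (a'.2, q.2)) :=
    congrFun₂ (blockSnd_leftMap_tensorMap_depolarize_left Ψ ρ p.2 q.2) a a'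
  simp only [contract_apply, hentry, Fintype.sum_prod_type, marginalSnd, Matrix.of_apply,
    Finset.sum_mul, Finset.mul_sum, Fintype.card_prod, Nat.cast_mul, Matrix.one_apply, ite_mul,
    one_mul, zero_mul, mul_ite, mul_zero]
  rw [Finset.sum_comm]
  refine Finset.sum_congr rfl fun y _ => ?_
  conv_rhs => rw [Finset.sum_comm]
  refine Finset.sum_congr rfl fun x _ => ?_
  rw [Finset.sum_comm]
  refine Finset.sum_congr rfl fun z _ => ?_
  have : Nonempty A₁ := ⟨x⟩
  have hd : (Fintype.card A₁ : ℂ) ≠ 0 := Nat.cast_ne_zero.mpr Fintype.card_ne_zero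
  rw [Finset.sum_ite_eq, if_pos (Finset.mem_univ x)]
  field_simp

lemma contract_leftMap_tensorMap_depolarize_right [DecidableEq A₂]
    (Φ : Module.End ℂ (Matrix A₁ A₁ ℂ)) (τ : Matrix ((A₁ × A₂) × B) ((A₁ × A₂) × B) ℂ)
    (ρ : Matrix ((A₁ × A₂) × R) ((A₁ × A₂) × R) ℂ) :
    contract τ (leftMap R (tensorMap Φ (depolarize A₂)) ρ) =
      contract (marginalFst τ) (leftMap R Φ (marginalFst ρ)) := by
  ext p q
  have hentry (a a' : A₁ × A₂) :
      leftMap R (tensorMap Φ (depolarize A₂)) ρ (a, p.2) (a', q.2) = (Fintype.card A₂ : ℂ)⁻¹ *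
        (leftMap R Φ (marginalFst ρ) (a.1, p.2) (a'.1, q.2) * (1 : Matrix A₂ A₂ ℂ) a.2 a'.2) :=
    congrFun₂ (blockSnd_leftMap_tensorMap_depolarize_right Φ ρ p.2 q.2) a a'
  simp only [contract_apply, hentry, Fintype.sum_prod_type, marginalFst, Matrix.of_apply,
    Finset.sum_mul, Finset.mul_sum, Fintype.card_prod, Nat.cast_mul, Matrix.one_apply, mul_one,
    mul_ite, mul_zero, Finset.sum_ite_eq, Finset.mem_univ, if_true]
  refine Finset.sum_congr rfl fun x _ => ?_
  rw [Finset.sum_comm]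
  refine Finset.sum_congr rfl fun z _ => Finset.sum_congr rfl fun y _ => ?_
  have : Nonempty A₂ := ⟨y⟩
  have hd : (Fintype.card A₂ : ℂ) ≠ 0 := Nat.cast_ne_zero.mpr Fintype.card_ne_zero
  field_simp

end Decomposition

section Choi

lemma posSemidef_epr {A : Type*} [Fintype A] [DecidableEq A] : (epr A).PosSemidef := by
  let v : A × A → ℂ := fun p => if p.1 = p.2 then 1 else 0
  have h : epr A = (Fintype.card A : ℂ)⁻¹ • Matrix.vecMulVec v (star v) := by
    ext p q
    simp only [epr, v, Matrix.of_apply, Matrix.smul_apply, Matrix.vecMulVec_apply, Pi.star_apply,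
      apply_ite star, star_one, star_zero, smul_eq_mul, mul_ite, mul_one, mul_zero, ← ite_and,
      and_comm]
  rw [h]
  exact (Matrix.posSemidef_vecMulVec_self_star v).smul (inv_nonneg.mpr (Nat.cast_nonneg _))

variable {A₁ A₂ B R : Type*} [Fintype A₁] [DecidableEq A₁] [Fintype A₂] [DecidableEq A₂]

lemma eprPair_eq_epr : eprPair A₁ A₂ = epr (A₁ × A₂) := by
  ext p q
  simp only [eprPair, epr, Matrix.submatrix_apply, Matrix.kroneckerMap_apply, Matrix.of_apply,
    Equiv.prodProdProdComm_apply, Prod.ext_iff, Fintype.card_prod, Nat.cast_mul, mul_inv]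
  rw [ite_zero_mul_ite_zero]
  exact if_congr (and_and_and_comm) rfl rfl

lemma choiState_apply (T : Matrix (A₁ × A₂) (A₁ × A₂) ℂ →ₗ[ℂ] Matrix B B ℂ)
    (p q : (A₁ × A₂) × B) : choiState T p q =
      (Fintype.card (A₁ × A₂) : ℂ)⁻¹ * T (Matrix.single p.1 q.1 1) p.2 q.2 := by
  have hblock : blockSnd (eprPair A₁ A₂) p.1 q.1 =
      (Fintype.card (A₁ × A₂) : ℂ)⁻¹ • Matrix.single p.1 q.1 1 := by
    ext a a'
    simp only [eprPair_eq_epr, epr, blockSnd, Matrix.submatrix_apply, Matrix.of_apply,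
      Matrix.smul_apply, Matrix.single_apply, smul_eq_mul, mul_ite, mul_one, mul_zero, eq_comm]
  change T (blockSnd (eprPair A₁ A₂) p.1 q.1) p.2 q.2 = _
  rw [hblock, map_smul, Matrix.smul_apply, smul_eq_mul]

lemma leftMap_eq_contract_choiState (T : Matrix (A₁ × A₂) (A₁ × A₂) ℂ →ₗ[ℂ] Matrix B B ℂ)
    (M : Matrix ((A₁ × A₂) × R) ((A₁ × A₂) × R) ℂ) : leftMap R T M = contract (choiState T) M := by
  ext p q
  have hexpand := Matrix.matrix_eq_sum_single (blockSnd M p.2 q.2)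
  have hleft : leftMap R T M p q =
      ∑ a, ∑ a', T (Matrix.single a a' (blockSnd M p.2 q.2 a a')) p.1 q.1 := by
    change T (blockSnd M p.2 q.2) p.1 q.1 = _
    conv_lhs => rw [hexpand]
    simp only [map_sum, Matrix.sum_apply]
  rw [hleft, contract_apply, Finset.mul_sum]
  refine Finset.sum_congr rfl fun a _ => ?_
  rw [Finset.mul_sum]
  refine Finset.sum_congr rfl fun a' _ => ?_
  have : Nonempty (A₁ × A₂) := ⟨a⟩
  have hcard : (Fintype.card (A₁ × A₂) : ℂ) ≠ 0 := Nat.cast_ne_zero.mpr Fintype.card_ne_zero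
  have hsingle : Matrix.single a a' (M (a, p.2) (a', q.2)) =
      M (a, p.2) (a', q.2) • Matrix.single a a' (1 : ℂ) := by
    rw [Matrix.smul_single, smul_eq_mul, mul_one]
  rw [choiState_apply, ← mul_assoc, mul_inv_cancel_left₀ hcard, mul_comm]
  change T (Matrix.single a a' (M (a, p.2) (a', q.2))) p.1 q.1 = _
  rw [hsingle, map_smul, Matrix.smul_apply, smul_eq_mul]

lemma trace_choiState [Fintype B] (T : Matrix (A₁ × A₂) (A₁ × A₂) ℂ →ₗ[ℂ] Matrix B B ℂ) :
    (choiState T).trace =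
      (T ((Fintype.card (A₁ × A₂) : ℂ)⁻¹ • (1 : Matrix (A₁ × A₂) (A₁ × A₂) ℂ))).trace := by
  rw [map_smul, ← Matrix.sum_single_one, map_sum, Matrix.trace_smul, Matrix.trace_sum]
  simp only [Matrix.trace, Matrix.diag, choiState_apply, Fintype.sum_prod_type (α₁ := A₁ × A₂),
    Finset.mul_sum, smul_eq_mul]

lemma isSubnormalised_choiState [Fintype B]
    {T : Matrix (A₁ × A₂) (A₁ × A₂) ℂ →ₗ[ℂ] Matrix B B ℂ} (hT : IsCompletelyPositive T)
    (hT' : IsTraceNonincreasing T) : IsSubnormalised (choiState T) := by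
  have hpair : (eprPair A₁ A₂).PosSemidef := eprPair_eq_epr (A₁ := A₁) (A₂ := A₂) ▸ posSemidef_epr
  refine ⟨(hT.posSemidef_leftMap hpair).submatrix Prod.swap, ?_⟩
  have hmixed : ((Fintype.card (A₁ × A₂) : ℂ)⁻¹ •
      (1 : Matrix (A₁ × A₂) (A₁ × A₂) ℂ)).PosSemidef :=
    Matrix.PosSemidef.one.smul (inv_nonneg.mpr (Nat.cast_nonneg _))
  rw [trace_choiState]
  refine (hT' _ hmixed).trans ?_
  rw [Matrix.trace_smul, Matrix.trace_one, smul_eq_mul]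
  rw [← Complex.ofReal_natCast, ← Complex.ofReal_inv, ← Complex.ofReal_mul, Complex.ofReal_re]
  exact inv_mul_le_one

end Choi

section Bipartite

variable {A₁ A₂ B R : Type*} [Fintype A₁] [DecidableEq A₁] [Fintype A₂] [DecidableEq A₂]

lemma perturbedState_sub_eq [Fintype R] [DecidableEq R]
    (T : Matrix (A₁ × A₂) (A₁ × A₂) ℂ →ₗ[ℂ] Matrix B B ℂ)
    (ρ : Matrix ((A₁ × A₂) × R) ((A₁ × A₂) × R) ℂ) (U : Matrix A₁ A₁ ℂ) (W : Matrix A₂ A₂ ℂ) :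
    perturbedState T ρ U W - traceLeft (choiState T) ⊗ₖ traceLeft ρ =
      contract (marginalFst (choiState T))
        (leftMap R (conjMap U - depolarize A₁) (marginalFst ρ)) +
      contract (marginalSnd (choiState T))
        (leftMap R (conjMap W - depolarize A₂) (marginalSnd ρ)) +
      contract (choiState T) (leftMap R
        (tensorMap (conjMap U) (conjMap W) + tensorMap (depolarize A₁) (depolarize A₂) -
          (tensorMap (conjMap U) (depolarize A₂) + tensorMap (depolarize A₁) (conjMap W))) ρ) := by
  have hconj : perturbedState T ρ U W =
      contract (choiState T) (leftMap R (tensorMap (conjMap U) (conjMap W)) ρ) := by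
    rw [← leftMap_eq_contract_choiState, tensorMap_conjMap, leftMap_conjMap]
    rfl
  rw [hconj, ← contract_leftMap_tensorMap_depolarize_left,
    ← contract_leftMap_tensorMap_depolarize_right, ← contract_leftMap_depolarize,
    ← tensorMap_depolarize]
  simp only [← map_sub, ← map_add, ← LinearMap.sub_apply, ← LinearMap.add_apply, ← leftMap_sub,
    ← leftMap_add, tensorMap_sub_left, tensorMap_sub_right]
  congr 3
  abel

lemma IsDecouplingFamily.lintegral_schattenNorm_one_bipartite_le [Fintype B] [DecidableEq B]
    [Fintype R] [DecidableEq R] {Ω Ω' : Type*} [TopologicalSpace Ω] [CompactSpace Ω]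
    [MeasurableSpace Ω] [OpensMeasurableSpace Ω] [TopologicalSpace Ω'] [CompactSpace Ω']
    [MeasurableSpace Ω'] [OpensMeasurableSpace Ω'] [SecondCountableTopologyEither Ω Ω']
    {μ : Measure Ω} [IsProbabilityMeasure μ] {ν : Measure Ω'} [IsProbabilityMeasure ν]
    {L L' : Ω → Module.End ℂ (Matrix A₁ A₁ ℂ)} {M M' : Ω' → Module.End ℂ (Matrix A₂ A₂ ℂ)}
    {c c' κ κ' : ℝ} (hL : IsDecouplingFamily μ L L' c κ) (hM : IsDecouplingFamily ν M M' c' κ')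
    {X : Matrix ((A₁ × A₂) × B) ((A₁ × A₂) × B) ℂ} {Y : Matrix ((A₁ × A₂) × R) ((A₁ × A₂) × R) ℂ}
    (hX : IsSubnormalised X) (hY : IsSubnormalised Y) {ε : ℝ} (hε : 0 ≤ ε) :
    ∫⁻ ω, ENNReal.ofReal (schattenNorm 1
        (contract (marginalFst X) (leftMap R (L ω.1 - L' ω.1) (marginalFst Y)) +
          contract (marginalSnd X) (leftMap R (M ω.2 - M' ω.2) (marginalSnd Y)) +
          contract X (leftMap R (tensorMap (L ω.1) (M ω.2) + tensorMap (L' ω.1) (M' ω.2) -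
            (tensorMap (L ω.1) (M' ω.2) + tensorMap (L' ω.1) (M ω.2))) Y))) ∂(μ.prod ν) ≤
      decouplingBound c κ ε (marginalFst X) (marginalFst Y) +
        decouplingBound c' κ' ε (marginalSnd X) (marginalSnd Y) +
        decouplingBound (c * c') (κ * κ') ε X Y := by
  have hFst (ω : Ω × Ω') :=
    hL.isHermitian_contract hX.marginalFst.1.isHermitian hY.marginalFst.1.isHermitian ω.1
  have hSnd (ω : Ω × Ω') :=
    hM.isHermitian_contract hX.marginalSnd.1.isHermitian hY.marginalSnd.1.isHermitian ω.2
  have hPair := (hL.tensor hM).isHermitian_contract hX.1.isHermitian hY.1.isHermitian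
  refine (lintegral_schattenNorm_one_add_le (fun ω => (hFst ω).add (hSnd ω)) hPair
    ((hL.tensor hM).continuous_contract X Y)).trans (add_le_add
      ((lintegral_schattenNorm_one_add_le hFst hSnd
        ((hM.continuous_contract _ _).comp continuous_snd)).trans (add_le_add ?_ ?_)) ?_)
  · exact hL.lintegral_schattenNorm_one_comp_le measurePreserving_fst hX.marginalFst
      hY.marginalFst hε
  · exact hM.lintegral_schattenNorm_one_comp_le measurePreserving_snd hX.marginalSnd
      hY.marginalSnd hε
  · exact (hL.tensor hM).lintegral_schattenNorm_one_le_decouplingBound hX hY hε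

end Bipartite

end Decoupling

end

open Decoupling in
theorem mainTheorem4_general {A₁ A₂ B R : Type*} [Fintype A₁] [DecidableEq A₁] [Nontrivial A₁]
    [Fintype A₂] [DecidableEq A₂] [Nontrivial A₂] [Fintype B] [DecidableEq B] [Fintype R]
    [DecidableEq R] {T : Matrix (A₁ × A₂) (A₁ × A₂) ℂ →ₗ[ℂ] Matrix B B ℂ}
    (hT : IsCompletelyPositive T) (hT' : IsTraceNonincreasing T)
    {ρ : Matrix ((A₁ × A₂) × R) ((A₁ × A₂) × R) ℂ} (hρ : IsSubnormalised ρ) {ε : ℝ} (hε : 0 ≤ ε) :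
    ∫⁻ U, ENNReal.ofReal (schattenNorm 1
        (perturbedState T ρ U.1.1 U.2.1 - traceLeft (choiState T) ⊗ₖ traceLeft ρ))
        ∂((unitaryHaar A₁).prod (unitaryHaar A₂))
      ≤ ENNReal.ofReal (16 * ε)
        + ENNReal.ofReal (dimFactor A₁) *
          pow2 (-((1 / 2 : ℝ) : EReal) * smoothCondEntropy ε (marginalFst ρ)
            - ((1 / 2 : ℝ) : EReal) * smoothCondEntropy ε (marginalFst (choiState T)))
        + ENNReal.ofReal (dimFactor A₂) *
          pow2 (-((1 / 2 : ℝ) : EReal) * smoothCondEntropy ε (marginalSnd ρ)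
            - ((1 / 2 : ℝ) : EReal) * smoothCondEntropy ε (marginalSnd (choiState T)))
        + ENNReal.ofReal (dimFactor A₁ * dimFactor A₂) *
          pow2 (-((1 / 2 : ℝ) : EReal) * smoothCondEntropy ε ρ
            - ((1 / 2 : ℝ) : EReal) * smoothCondEntropy ε (choiState T)) := by
  simp only [perturbedState_sub_eq]
  refine ((IsDecouplingFamily.unitaryHaar (A := A₁)).lintegral_schattenNorm_one_bipartite_le
    (IsDecouplingFamily.unitaryHaar (A := A₂)) (isSubnormalised_choiState hT hT') hρ hε).trans_eq ?_
  simp only [decouplingBound]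
  rw [show 16 * ε = 2 * 2 * ε + 2 * 2 * ε + 2 * (2 * 2) * ε by ring,
    ENNReal.ofReal_add (by positivity) (by positivity),
    ENNReal.ofReal_add (by positivity) (by positivity)]
  ring

open Decoupling in
theorem mainTheorem4
    {A₁ A₂ B R : Type*}
    [Fintype A₁] [DecidableEq A₁] [Fintype A₂] [DecidableEq A₂]
    [Fintype B] [DecidableEq B] [Fintype R] [DecidableEq R]
    (hA₁ : 2 ≤ Fintype.card A₁) (hA₂ : 2 ≤ Fintype.card A₂)
    (T : Matrix (A₁ × A₂) (A₁ × A₂) ℂ →ₗ[ℂ] Matrix B B ℂ)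
    (hT : IsCompletelyPositive T) (hT' : IsTraceNonincreasing T)
    (ρ : Matrix ((A₁ × A₂) × R) ((A₁ × A₂) × R) ℂ) (hρ : IsSubnormalised ρ)
    (ε : ℝ) (hε : 0 < ε) (hε' : ε < 1)
    (τ : Matrix ((A₁ × A₂) × B) ((A₁ × A₂) × B) ℂ) (hτ : τ = choiState T)
    (D₁ D₂ D₁₂ : ℝ) (hD₁ : D₁ = dimFactor A₁) (hD₂ : D₂ = dimFactor A₂)
    (hD₁₂ : D₁₂ = 2 * dimFactor A₁ * dimFactor A₂) :
    ∫⁻ U, ENNReal.ofReal (schattenNorm 1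
        (perturbedState T ρ U.1.1 U.2.1 - traceLeft τ ⊗ₖ traceLeft ρ))
        ∂((unitaryHaar A₁).prod (unitaryHaar A₂))
      ≤ ENNReal.ofReal (16 * ε)
        + ENNReal.ofReal (2 * D₁) *
          pow2 (-((1 / 2 : ℝ) : EReal) * smoothCondEntropy ε (marginalFst ρ)
            - ((1 / 2 : ℝ) : EReal) * smoothCondEntropy ε (marginalFst τ))
        + ENNReal.ofReal (2 * D₂) *
          pow2 (-((1 / 2 : ℝ) : EReal) * smoothCondEntropy ε (marginalSnd ρ)
            - ((1 / 2 : ℝ) : EReal) * smoothCondEntropy ε (marginalSnd τ))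
        + ENNReal.ofReal (4 * D₁₂) *
          pow2 (-((1 / 2 : ℝ) : EReal) * smoothCondEntropy ε ρ
            - ((1 / 2 : ℝ) : EReal) * smoothCondEntropy ε τ) := by
  have := Fintype.one_lt_card_iff_nontrivial.mp hA₁
  have := Fintype.one_lt_card_iff_nontrivial.mp hA₂
  subst hτ hD₁ hD₂ hD₁₂
  have h₁ := dimFactor_nonneg A₁
  have h₂ := dimFactor_nonneg A₂
  have hD₁ : dimFactor A₁ ≤ 2 * dimFactor A₁ := by linarith
  have hD₂ : dimFactor A₂ ≤ 2 * dimFactor A₂ := by linarith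
  have hD₁₂ : dimFactor A₁ * dimFactor A₂ ≤ 4 * (2 * dimFactor A₁ * dimFactor A₂) := by
    linarith [mul_nonneg h₁ h₂]
  refine (mainTheorem4_general hT hT' hρ hε.le).trans ?_
  gcongr
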